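/- Throughout, $E$ is a finite linearly ordered set and $M,N$ are oriented matroids on $E$ such that $M\to N$ is an oriented matroid perspective, i.e. every (signed) circuit of $M$ is a vector (a conformal union of signed circuits) of $N$. For $A\subseteq E$, $-_AM$ denotes the reorientation of $M$ obtained by reversing the signs of the elements of $A$ in all circuits. Let $$O(M)=\{\min C : C\text{ positive circuit of }M\}=\{g_1<\dots<g_\varepsilon\},\qquad O^*(N)=\{\min D : D\text{ positive cocircuit of }N\}=\{h_1<\dots<h_\iota\}.$$ Put $G_\varepsilon=\emptyset$ and, for $0\le k<\varepsilon$, let $G_k$ be the union of the positive circuits $C$ of $M$ with $\min C\ge g_{k+1}$; put $H_\iota=E$ and, for $0\le k<\iota$, let $E\setminus H_k$ be the union of the positive cocircuits $D$ of $N$ with $\min D\ge h_{k+1}$. The active partition of $M\to N$ consists of the cyclic parts $G_{k-1}\setminus G_k$ ($1\le k\le\varepsilon$), the acyclic parts $H_k\setminus H_{k-1}$ ($1\le k\le\iota$), and the (possibly empty) hybrid part $H_0\setminus G_0$. For $A\subseteq E$, the activity class $cl(A)\subseteq 2^E$ is the set of all $A\mathbin{\triangle}X$, where $X$ is a union of cyclic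 or acyclic parts of the active partition of $-_AM\to-_AN$. **Proposition.** 1. If $A\subseteq E$ is any union of (cyclic, acyclic or hybrid) parts of the active partition of $M\to N$, then $-_AM\to-_AN$ is an oriented matroid perspective and has the same active partition as $M\to N$: the same cyclic parts, the same acyclic parts and the same hybrid part. 2. The distinct sets $cl(A)$, $A\subseteq E$, form a partition of $2^E$. 3. Each class is a boolean lattice: for every $A\subseteq E$, mapping $S\subseteq O(-_AM)\cup O^*(-_AN)$ to the union $X_S$ of those cyclic or acyclic parts $B$ of the active partition of $-_AM\to-_AN$ with $\min B\in S$ is an order isomorphism from the power set of $O(-_AM)\cup O^*(-_AN)$ onto $\{X\subseteq E : A\mathbin{\triangle}X\in cl(A)\}$, ordered by inclusion. -/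

import Mathlib

open scoped symmDiff

/-- A signed subset of `E`: the elements with value `1` form its positive part, those with
value `-1` its negative part; its support is `Function.support X`. -/
abbrev SignedSet (E : Type*) := E → SignType

namespace SignedSet

variable {E : Type*}

/-- A signed set with empty negative part. -/
def Positive (X : SignedSet E) : Prop := ∀ e, 0 ≤ X e

/-- Two signed sets are conformal if they have the same signs on the intersection of their
supports. -/
def Conformal (X Y : SignedSet E) : Prop := ∀ e, X e ≠ 0 → Y e ≠ 0 → X e = Y e

/-- `X` is the union of the signed sets in `S`: its positive (negative) part is the union of
the positive (negative) parts of the members of `S`. -/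
def IsUnion (X : SignedSet E) (S : Set (SignedSet E)) : Prop :=
  ∀ e, (X e = 1 ↔ ∃ C ∈ S, C e = 1) ∧ (X e = -1 ↔ ∃ C ∈ S, C e = -1)

/-- Orthogonality: the supports are disjoint, or the two signed sets agree at some element of
the intersection of the supports and disagree at another one. -/
def Orthogonal (X Y : SignedSet E) : Prop :=
  (∀ e, X e * Y e = 0) ∨ ((∃ e, X e * Y e = 1) ∧ ∃ f, X f * Y f = -1)

open Classical in
/-- Reversal of the signs on `A`. -/
noncomputable def reorient (A : Set E) (X : SignedSet E) : SignedSet E :=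
  fun e => if e ∈ A then -X e else X e

theorem neg_eq_one (s : SignType) : -s = 1 ↔ s = -1 := by
  revert s
  decide

theorem neg_eq_neg_one (s : SignType) : -s = -1 ↔ s = 1 := by
  revert s
  decide

theorem reorient_neg (A : Set E) (X : SignedSet E) : reorient A (-X) = -reorient A X := by
  funext e
  by_cases h : e ∈ A <;> simp [reorient, h]

theorem reorient_eq_zero (A : Set E) (X : SignedSet E) (e : E) :
    reorient A X e = 0 ↔ X e = 0 := by
  by_cases h : e ∈ A <;> simp [reorient, h]

theorem support_reorient (A : Set E) (X : SignedSet E) :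
    Function.support (reorient A X) = Function.support X := by
  ext e
  simp [reorient_eq_zero]

end SignedSet

/-- An oriented matroid on the ground set `E`, given by its signed circuits. -/
@[ext]
structure OrientedMatroid (E : Type*) where
  circuits : Set (SignedSet E)
  zero_notMem : (0 : SignedSet E) ∉ circuits
  neg_mem : ∀ X ∈ circuits, -X ∈ circuits
  eq_or_eq_neg : ∀ X ∈ circuits, ∀ Y ∈ circuits,
    Function.support X ⊆ Function.support Y → X = Y ∨ X = -Y
  elimination : ∀ X ∈ circuits, ∀ Y ∈ circuits, X ≠ -Y → ∀ e, X e = 1 → Y e = -1 →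
    ∃ Z ∈ circuits, Z e = 0 ∧ (∀ f, Z f = 1 → X f = 1 ∨ Y f = 1) ∧
      ∀ f, Z f = -1 → X f = -1 ∨ Y f = -1

namespace OrientedMatroid

variable {E : Type*}

/-- The reorientation `-_A M`. -/
noncomputable def reorient (M : OrientedMatroid E) (A : Set E) : OrientedMatroid E where
  circuits := SignedSet.reorient A '' M.circuits
  zero_notMem := by
    rintro ⟨X, hX, h⟩
    have : X = 0 := by
      funext e
      exact (SignedSet.reorient_eq_zero A X e).1 (congrFun h e)
    exact M.zero_notMem (this ▸ hX)
  neg_mem := by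
    rintro _ ⟨X, hX, rfl⟩
    exact ⟨-X, M.neg_mem X hX, SignedSet.reorient_neg A X⟩
  eq_or_eq_neg := by
    rintro _ ⟨X, hX, rfl⟩ _ ⟨Y, hY, rfl⟩ h
    rw [SignedSet.support_reorient, SignedSet.support_reorient] at h
    rcases M.eq_or_eq_neg X hX Y hY h with h | h
    · exact Or.inl (by rw [h])
    · exact Or.inr (by rw [h, SignedSet.reorient_neg])
  elimination := by
    rintro _ ⟨X, hX, rfl⟩ _ ⟨Y, hY, rfl⟩ hne e hXe hYe
    have hne' : X ≠ -Y := fun h => hne (by rw [h, SignedSet.reorient_neg])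
    have hne'' : Y ≠ -X := fun h => hne' (by rw [h, neg_neg])
    by_cases he : e ∈ A
    · simp only [SignedSet.reorient, he, if_true] at hXe hYe
      obtain ⟨Z, hZ, h0, h1, h2⟩ := M.elimination Y hY X hX hne'' e
        (by simpa using hYe) (by rw [← hXe, neg_neg])
      refine ⟨_, ⟨Z, hZ, rfl⟩, (SignedSet.reorient_eq_zero A Z e).2 h0, ?_, ?_⟩ <;>
        intro f hf <;> by_cases hfA : f ∈ A <;>
        simp only [SignedSet.reorient, hfA, if_true, if_false, SignedSet.neg_eq_one,
          SignedSet.neg_eq_neg_one] at hf ⊢ <;>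
        grind
    · simp only [SignedSet.reorient, he, if_false] at hXe hYe
      obtain ⟨Z, hZ, h0, h1, h2⟩ := M.elimination X hX Y hY hne' e hXe hYe
      refine ⟨_, ⟨Z, hZ, rfl⟩, (SignedSet.reorient_eq_zero A Z e).2 h0, ?_, ?_⟩ <;>
        intro f hf <;> by_cases hfA : f ∈ A <;>
        simp only [SignedSet.reorient, hfA, if_true, if_false, SignedSet.neg_eq_one,
          SignedSet.neg_eq_neg_one] at hf ⊢ <;>
        grind

/-- The signed cocircuits, that is, the signed circuits of the dual: the nonzero signed sets
orthogonal to all circuits whose support is minimal among these. -/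
def cocircuits (M : OrientedMatroid E) : Set (SignedSet E) :=
  {D | D ≠ 0 ∧ (∀ C ∈ M.circuits, SignedSet.Orthogonal C D) ∧
    ∀ D' : SignedSet E, D' ≠ 0 → (∀ C ∈ M.circuits, SignedSet.Orthogonal C D') →
      Function.support D' ⊆ Function.support D → Function.support D' = Function.support D}

/-- A vector is a conformal union of circuits. -/
def IsVector (M : OrientedMatroid E) (X : SignedSet E) : Prop :=
  ∃ S ⊆ M.circuits, S.Pairwise SignedSet.Conformal ∧ X.IsUnion S

/-- `M → N` is an oriented matroid perspective: every circuit of `M` is a vector of `N`. -/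
def IsPerspective (M N : OrientedMatroid E) : Prop :=
  ∀ C ∈ M.circuits, N.IsVector C

section Order

variable [LinearOrder E]

/-- `O(M)`: the smallest elements of the positive circuits. -/
def active (M : OrientedMatroid E) : Set E :=
  {e | ∃ C ∈ M.circuits, C.Positive ∧ IsLeast (Function.support C) e}

/-- `O*(M)`: the smallest elements of the positive cocircuits. -/
def dualActive (M : OrientedMatroid E) : Set E :=
  {e | ∃ D ∈ M.cocircuits, D.Positive ∧ IsLeast (Function.support D) e}

variable [Finite E]

/-- The increasing enumeration of a subset of `E`, starting at index `0`. -/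
noncomputable def enum (S : Set E) : Fin S.ncard ↪o E :=
  S.toFinite.toFinset.orderEmbOfFin (Set.ncard_eq_toFinset_card S).symm

/-- The set `G_k` of the active filtration. With `O(M) = {g_1 < ... < g_ε}` it is, for `k < ε`,
the union of the positive circuits `C` of `M` with `min C ≥ g_(k+1)`, and it is empty for
`k = ε`. (As `enum` starts at `0`, `g_(k+1)` is its value at `k`.) -/
def filtrationG (M : OrientedMatroid E) (k : ℕ) : Set E :=
  {e | ∃ hk : k < M.active.ncard, ∃ C ∈ M.circuits, C.Positive ∧
    (∀ f ∈ Function.support C, enum M.active ⟨k, hk⟩ ≤ f) ∧ e ∈ Function.support C}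

/-- The set `H_k` of the active filtration. With `O*(N) = {h_1 < ... < h_ι}` it is, for `k < ι`,
the complement of the union of the positive cocircuits `D` of `N` with `min D ≥ h_(k+1)`,
and it is `E` for `k = ι`. -/
def filtrationH (N : OrientedMatroid E) (k : ℕ) : Set E :=
  {e | ∃ hk : k < N.dualActive.ncard, ∃ D ∈ N.cocircuits, D.Positive ∧
    (∀ f ∈ Function.support D, enum N.dualActive ⟨k, hk⟩ ≤ f) ∧ e ∈ Function.support D}ᶜ

end Order

end OrientedMatroid

/-- The data of an active partition: its cyclic parts, its acyclic parts and its (possibly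
empty) hybrid part. -/
@[ext]
structure ActivePartition (E : Type*) where
  cyclicParts : Set (Set E)
  acyclicParts : Set (Set E)
  hybridPart : Set E

/-- All the parts of an active partition. -/
def ActivePartition.parts {E : Type*} (P : ActivePartition E) : Set (Set E) :=
  P.cyclicParts ∪ P.acyclicParts ∪ {P.hybridPart}

namespace OrientedMatroid

variable {E : Type*} [LinearOrder E] [Finite E]

/-- The active partition of `M → N`: the cyclic parts `G_(k-1) \ G_k` for `1 ≤ k ≤ ε`, the
acyclic parts `H_k \ H_(k-1)` for `1 ≤ k ≤ ι` and the hybrid part `H_0 \ G_0`. -/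
def activePartition (M N : OrientedMatroid E) : ActivePartition E where
  cyclicParts := {B | ∃ k < M.active.ncard, B = M.filtrationG k \ M.filtrationG (k + 1)}
  acyclicParts := {B | ∃ k < N.dualActive.ncard, B = N.filtrationH (k + 1) \ N.filtrationH k}
  hybridPart := N.filtrationH 0 \ M.filtrationG 0

/-- The cyclic and acyclic parts of the active partition of `-_A M → -_A N`. -/
def activeParts (M N : OrientedMatroid E) (A : Set E) : Set (Set E) :=
  (activePartition (M.reorient A) (N.reorient A)).cyclicParts ∪
    (activePartition (M.reorient A) (N.reorient A)).acyclicParts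

/-- The activity class of `A` with respect to `M → N`: the sets (identified with reorientations
of `M → N`) obtained from `A` by further reorienting any union of cyclic or acyclic parts of the
active partition of `-_A M → -_A N`. -/
def activityClass (M N : OrientedMatroid E) (A : Set E) : Set (Set E) :=
  {A' | ∃ T ⊆ activeParts M N A, A' = A ∆ ⋃₀ T}

end OrientedMatroid

/-!
Vectors and covectors are handled through orthogonality: covectors are the signed sets
orthogonal to all circuits, vectors those orthogonal to all covectors. With this choice both
families are closed under opposites and compositions and commute with reorientation, and for a
perspective `M → N` every vector of `M` is orthogonal to every covector of `N`
(`IsPerspective.orthogonal`).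

Circuits and cocircuits enter only through two decomposition results: each element of a positive
vector lies in a positive circuit inside it (`exists_circuit_of_mem_vectors`), and likewise for
covectors and cocircuits (`exists_cocircuit_of_mem_covectors`). They follow from the painting
lemma `painting`, which is deduced from strong elimination of circuits (`strong_elimination`), and
that in turn from the weak elimination axiom.

The active partition can therefore be described for any family `V` closed under opposites and
compositions. Its parts are indexed by the active elements `a`, the part of `a` being the union of
the positive members supported in `[a, ∞)` minus the union of those supported in `(a, ∞)`; it has
smallest element `a`. Let `A` be a union of parts. Composing positive members of `V` with suitable
signs, one part after another, gives a member with the same support that is positive after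
reorientation of `A` (`positiveUnion_subset_reorient`). Conversely, let `u` be positive after
reorientation. By orthogonality `u` avoids the parts of the dual family. On the hybrid part, or on
the first part which it meets, `u` has constant sign in `V`, and a composition of `u` or `-u` after
a positive member of `V` is a positive member that contradicts the definition of the parts, unless
`u` lies where it should (`positiveUnion_reorient_subset`). Hence reorienting `A` preserves the
active partition (`activePartition_reorient_sUnion`).

Since the parts are pairwise disjoint, their unions form a group under symmetric difference, so the
activity classes behave like cosets and partition the power set; and since the active elements are
exactly the smallest elements of the cyclic and acyclic parts, sets of active elements correspond to
unions of parts (`exists_orderIso_activityClass`).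
-/

/-! ### Strong elimination of circuits -/

namespace OrientedMatroid

variable {E : Type*} (M : OrientedMatroid E)

theorem exists_support_notMem {X Y : SignedSet E} (hX : X ∈ M.circuits) (hY : Y ∈ M.circuits)
    (h1 : X ≠ Y) (h2 : X ≠ -Y) : ∃ g, X g ≠ 0 ∧ Y g = 0 := by
  by_contra! h
  rcases M.eq_or_eq_neg X hX Y hY (fun e he => h e he) with h | h
  · exact h1 h
  · exact h2 h

theorem weak_elimination {X Y : SignedSet E} (hX : X ∈ M.circuits) (hY : Y ∈ M.circuits)
    (hne : X ≠ -Y) {e : E} (he : X e ≠ 0) (hXY : Y e = -X e) :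
    ∃ Z ∈ M.circuits, Z e = 0 ∧ ∀ k, Z k = 0 ∨ Z k = X k ∨ Z k = Y k := by
  have key : ∀ {X Y : SignedSet E}, X ∈ M.circuits → Y ∈ M.circuits → X ≠ -Y →
      X e = 1 → Y e = -1 →
      ∃ Z ∈ M.circuits, Z e = 0 ∧ ∀ k, Z k = 0 ∨ Z k = X k ∨ Z k = Y k := by
    intro X Y hX hY hne h1 h2
    obtain ⟨Z, hZ, h0, hp, hn⟩ := M.elimination X hX Y hY hne e h1 h2
    refine ⟨Z, hZ, h0, fun k => ?_⟩
    rcases h : Z k with _ | _ | _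
    · exact Or.inl rfl
    · exact Or.inr ((hn k h).imp Eq.symm Eq.symm)
    · exact Or.inr ((hp k h).imp Eq.symm Eq.symm)
  rcases h : X e with _ | _ | _
  · exact absurd h he
  · obtain ⟨Z, hZ, h0, hk⟩ := key hY hX (fun h' => hne (by rw [h', neg_neg]))
      (by rw [hXY, h]; rfl) h
    exact ⟨Z, hZ, h0, fun k => (hk k).imp_right Or.symm⟩
  · exact key hX hY hne h (by rw [hXY, h]; rfl)

variable [Finite E]

/-- Let `p k s` say that the sign `s` is allowed at `k`. If the signs of `Z` are allowed and those
of `Z'` are allowed except where they are opposite to `Z`, then eliminating the forbidden signs of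
`Z'` by means of `Z`, one after the other, gives a circuit with allowed signs. Each elimination
retains `f`, which lies in `Z'` but not in `Z`. -/
theorem exists_circuit_of_cleanup {t : Set E} {f : E}
    (helim : ∀ X ∈ M.circuits, ∀ Y ∈ M.circuits, Function.support X ⊆ t →
      Function.support Y ⊆ t → ∀ e, X e ≠ 0 → Y e = -X e → X f ≠ 0 → Y f = 0 →
      ∃ Z ∈ M.circuits, Z e = 0 ∧ Z f = X f ∧ ∀ k, Z k = 0 ∨ Z k = X k ∨ Z k = Y k)
    {Z : SignedSet E} (hZ : Z ∈ M.circuits) (hZt : Function.support Z ⊆ t) (hZf : Z f = 0)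
    (p : E → SignType → Prop) (hp : ∀ k, p k (Z k)) {Z' : SignedSet E} (hZ' : Z' ∈ M.circuits)
    (hZt' : Function.support Z' ⊆ t) (hZf' : Z' f ≠ 0)
    (hp' : ∀ k, Z' k = 0 ∨ p k (Z' k) ∨ Z' k = -Z k) :
    ∃ W ∈ M.circuits, Function.support W ⊆ t ∧ W f = Z' f ∧ ∀ k, W k = 0 ∨ p k (W k) := by
  induction hn : {k | Z' k ≠ 0 ∧ Z' k = -Z k}.ncard using Nat.strong_induction_on
    generalizing Z' with
  | _ n ih =>
    by_cases hbad : ∃ k, Z' k ≠ 0 ∧ Z' k = -Z k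
    · obtain ⟨k, hk, hkZ⟩ := hbad
      obtain ⟨Z'', hZ'', h0, hf, hc⟩ := helim Z' hZ' Z hZ hZt' hZt k hk
        (by rw [hkZ, neg_neg]) hZf' hZf
      have hlt : {k | Z'' k ≠ 0 ∧ Z'' k = -Z k}.ncard < n := by
        rw [← hn]
        refine Set.ncard_lt_ncard ⟨?_, fun h => (h ⟨hk, hkZ⟩ : k ∈ _).1 h0⟩
        rintro j ⟨h1, h2⟩
        rcases hc j with h | h | h
        · exact absurd h h1
        · exact ⟨h ▸ h1, h ▸ h2⟩
        · exact absurd (SignType.self_eq_neg_iff.1 (h.symm.trans h2)) (h ▸ h1)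
      have hs : Function.support Z'' ⊆ t := by
        intro j hj
        rcases hc j with h | h | h
        · exact absurd h hj
        · exact hZt' (show Z' j ≠ 0 from h ▸ hj)
        · exact hZt (show Z j ≠ 0 from h ▸ hj)
      have hpc : ∀ j, Z'' j = 0 ∨ p j (Z'' j) ∨ Z'' j = -Z j := by
        intro j
        rcases hc j with h | h | h
        · exact Or.inl h
        · rw [h]
          exact hp' j
        · rw [h]
          exact Or.inr (Or.inl (hp j))
      obtain ⟨W, hW, hWt, hWf, hWp⟩ := ih _ hlt hZ'' hs (hf ▸ hZf') hpc rfl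
      exact ⟨W, hW, hWt, hWf.trans hf, hWp⟩
    · push Not at hbad
      refine ⟨Z', hZ', hZt', rfl, fun k => ?_⟩
      by_cases hk : Z' k = 0
      · exact Or.inl hk
      · exact Or.inr (((hp' k).resolve_left hk).resolve_right (hbad k hk))

/-- Elimination retaining an element that lies in only one of the two circuits. As for unoriented
matroids, this is an induction on the size of the union of the supports; the new point is that the
two eliminations used there may produce signs of neither circuit, to be cleaned up afterwards. -/
theorem elimination_retaining_of_eq_zero {X Y : SignedSet E} (hX : X ∈ M.circuits)
    (hY : Y ∈ M.circuits) {e f : E} (he : X e ≠ 0) (hXY : Y e = -X e) (hf : X f ≠ 0)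
    (hfY : Y f = 0) :
    ∃ Z ∈ M.circuits, Z e = 0 ∧ Z f = X f ∧ ∀ k, Z k = 0 ∨ Z k = X k ∨ Z k = Y k := by
  induction hn : (Function.support X ∪ Function.support Y).ncard using Nat.strong_induction_on
    generalizing X Y e f with
  | _ n ih =>
    -- the induction hypothesis for circuits inside a proper part of the union
    have ih' : ∀ g ∈ Function.support X ∪ Function.support Y, ∀ X' ∈ M.circuits,
        ∀ Y' ∈ M.circuits,
        Function.support X' ⊆ (Function.support X ∪ Function.support Y) \ {g} →
        Function.support Y' ⊆ (Function.support X ∪ Function.support Y) \ {g} →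
        ∀ e f, X' e ≠ 0 → Y' e = -X' e → X' f ≠ 0 → Y' f = 0 →
        ∃ Z ∈ M.circuits, Z e = 0 ∧ Z f = X' f ∧ ∀ k, Z k = 0 ∨ Z k = X' k ∨ Z k = Y' k := by
      intro g hg X' hX' Y' hY' hXs hYs e f h1 h2 h3 h4
      refine ih _ ?_ hX' hY' h1 h2 h3 h4 rfl
      rw [← hn]
      refine Set.ncard_lt_ncard ⟨fun k hk => ?_, fun h => ?_⟩
      · exact ((Set.union_subset hXs hYs) hk).1
      · exact ((Set.union_subset hXs hYs) (h hg)).2 rfl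
    have hYe : Y e ≠ 0 := by
      rw [hXY]
      simpa using he
    obtain ⟨Z, hZ, hZe, hZc⟩ := M.weak_elimination hX hY
      (fun h => hf (by rw [h, Pi.neg_apply, hfY, neg_zero])) he hXY
    by_cases hZf : Z f = 0
    swap
    · refine ⟨Z, hZ, hZe, ?_, hZc⟩
      rcases hZc f with h | h | h
      · exact absurd h hZf
      · exact h
      · exact absurd (h.trans hfY) hZf
    have hZs : ∀ k, Z k ≠ 0 → X k ≠ 0 ∨ Y k ≠ 0 := fun k hk => by
      rcases hZc k with h | h | h
      · exact absurd h hk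
      · exact Or.inl (h ▸ hk)
      · exact Or.inr (h ▸ hk)
    obtain ⟨g, hgZ, hgX⟩ := M.exists_support_notMem hZ hX
      (fun h => he (by rw [← h, hZe]))
      (fun h => he (by simpa [hZe] using (congrFun h e).symm))
    have hgY : Z g = Y g := by
      rcases hZc g with h | h | h
      · exact absurd h hgZ
      · exact absurd (h.trans hgX) hgZ
      · exact h
    -- remove `g` from `Y` by means of `-Z`, retaining `e`
    obtain ⟨W, hW, hWg, hWe, hWc⟩ := ih' f (Or.inl hf) Y hY (-Z) (M.neg_mem Z hZ)
      (fun k hk => ⟨Or.inr hk, fun h => hk (by rw [h]; exact hfY)⟩)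
      (fun k hk => ⟨hZs k (fun h => hk (by rw [Pi.neg_apply, h, neg_zero])),
        fun h => hk (by rw [h, Pi.neg_apply, hZf, neg_zero])⟩)
      g e (hgY ▸ hgZ) (by rw [Pi.neg_apply, hgY]) hYe (by rw [Pi.neg_apply, hZe, neg_zero])
    have hWs : ∀ k, W k ≠ 0 → X k ≠ 0 ∨ Y k ≠ 0 := fun k hk => by
      rcases hWc k with h | h | h
      · exact absurd h hk
      · exact Or.inr (h ▸ hk)
      · exact hZs k (fun h' => hk (by rw [h, Pi.neg_apply, h', neg_zero]))
    have hWf : W f = 0 := by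
      rcases hWc f with h | h | h
      · exact h
      · exact h.trans hfY
      · rw [h, Pi.neg_apply, hZf, neg_zero]
    obtain ⟨Z', hZ', hZe', hZf', hZc'⟩ := ih' g (Or.inr (show Y g ≠ 0 from hgY ▸ hgZ)) X hX W hW
      (fun k hk => ⟨Or.inl hk, fun h => hk (by rw [h]; exact hgX)⟩)
      (fun k hk => ⟨hWs k hk, fun h => hk (by rw [h]; exact hWg)⟩)
      e f he (hWe.trans hXY) hf hWf
    -- the signs of `Z'` not coming from `X` or `Y` are opposite to those of `Z`
    obtain ⟨V, hV, hVt, hVf, hVc⟩ := M.exists_circuit_of_cleanup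
      (t := (Function.support X ∪ Function.support Y) \ {e}) (f := f)
      (fun X' hX' Y' hY' h1 h2 e' => ih' e (Or.inl he) X' hX' Y' hY' h1 h2 e' f)
      hZ (fun k hk => ⟨hZs k hk, fun h => hk (by rw [h]; exact hZe)⟩) hZf
      (fun k s => s = 0 ∨ s = X k ∨ s = Y k) hZc hZ'
      (fun k hk => ⟨by
        rcases hZc' k with h | h | h
        · exact absurd h hk
        · exact Or.inl (show X k ≠ 0 from h ▸ hk)
        · exact hWs k (h ▸ hk), fun h => hk (by rw [h]; exact hZe')⟩) (hZf' ▸ hf)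
      (fun k => by
        rcases hZc' k with h | h | h
        · exact Or.inl h
        · exact Or.inr (Or.inl (Or.inr (Or.inl h)))
        · rcases hWc k with h' | h' | h'
          · exact Or.inl (h.trans h')
          · exact Or.inr (Or.inl (Or.inr (Or.inr (h.trans h'))))
          · exact Or.inr (Or.inr (h.trans h')))
    refine ⟨V, hV, ?_, hVf.trans hZf', fun k => ?_⟩
    · by_contra h
      exact (hVt h).2 rfl
    · rcases hVc k with h | h
      · exact Or.inl h
      · exact h

/-- Strong elimination: the elimination of `e` may be required to retain an element `f` at which
the two circuits do not have opposite signs. -/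
theorem strong_elimination {X Y : SignedSet E} (hX : X ∈ M.circuits)
    (hY : Y ∈ M.circuits) {e f : E} (he : X e ≠ 0) (hXY : Y e = -X e) (hf : X f ≠ 0)
    (hfY : Y f = 0 ∨ Y f = X f) :
    ∃ Z ∈ M.circuits, Z e = 0 ∧ Z f = X f ∧ ∀ k, Z k = 0 ∨ Z k = X k ∨ Z k = Y k := by
  induction hn : (Function.support X ∪ Function.support Y).ncard using Nat.strong_induction_on
    generalizing X Y with
  | _ n ih =>
    rcases hfY with hfY | hfY
    · exact M.elimination_retaining_of_eq_zero hX hY he hXY hf hfY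
    have hne : X ≠ -Y := fun h => by
      have := congrFun h f
      rw [Pi.neg_apply, hfY] at this
      exact hf (SignType.self_eq_neg_iff.1 this)
    have hne' : X ≠ Y := fun h => by
      have := congrFun h e
      rw [hXY] at this
      exact he (SignType.self_eq_neg_iff.1 this)
    obtain ⟨h, hhX, hhY⟩ := M.exists_support_notMem hX hY hne' hne
    obtain ⟨Z, hZ, hZe, hZh, hZc⟩ :=
      M.elimination_retaining_of_eq_zero hX hY he hXY hhX hhY
    by_cases hZf : Z f = 0
    swap
    · refine ⟨Z, hZ, hZe, ?_, hZc⟩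
      rcases hZc f with h | h | h
      · exact absurd h hZf
      · exact h
      · exact h.trans hfY
    have hZs : ∀ k, Z k ≠ 0 → X k ≠ 0 ∨ Y k ≠ 0 := fun k hk => by
      rcases hZc k with h | h | h
      · exact absurd h hk
      · exact Or.inl (h ▸ hk)
      · exact Or.inr (h ▸ hk)
    -- remove `h` from `X` by means of `-Z`, retaining `f`
    obtain ⟨W, hW, hWh, hWf, hWc⟩ := M.elimination_retaining_of_eq_zero hX (M.neg_mem Z hZ)
      hhX (by rw [Pi.neg_apply, hZh]) hf (by rw [Pi.neg_apply, hZf, neg_zero])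
    -- a circuit without `e` whose wrong signs are opposite to those of `Z`
    obtain ⟨Z', hZ', hZe', hZf', hZc'⟩ : ∃ Z' ∈ M.circuits, Z' e = 0 ∧ Z' f = X f ∧
        ∀ k, Z' k = 0 ∨ (Z' k = 0 ∨ Z' k = X k ∨ Z' k = Y k) ∨ Z' k = -Z k := by
      have hWc' : ∀ k, W k = 0 ∨ (W k = 0 ∨ W k = X k ∨ W k = Y k) ∨ W k = -Z k := fun k => by
        rcases hWc k with h | h | h
        · exact Or.inl h
        · exact Or.inr (Or.inl (Or.inr (Or.inl h)))
        · exact Or.inr (Or.inr h)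
      by_cases hWe : W e = 0
      · exact ⟨W, hW, hWe, hWf, hWc'⟩
      · have hWe' : W e = X e := by
          rcases hWc e with h | h | h
          · exact absurd h hWe
          · exact h
          · exact absurd (by rw [h, Pi.neg_apply, hZe, neg_zero]) hWe
        have hlt : (Function.support W ∪ Function.support Y).ncard < n := by
          rw [← hn]
          refine Set.ncard_lt_ncard ⟨?_, fun hs => ?_⟩
          · rintro k (hk | hk)
            · rcases hWc k with h | h | h
              · exact absurd h hk
              · exact Or.inl (show X k ≠ 0 from h ▸ hk)
              · exact hZs k (fun h' => hk (by rw [h, Pi.neg_apply, h', neg_zero]))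
            · exact Or.inr hk
          · rcases hs (Or.inl hhX : h ∈ _) with h' | h'
            · exact h' hWh
            · exact h' hhY
        obtain ⟨Z', hZ', h1, h2, h3⟩ := ih _ hlt hW hY hWe (by rw [hXY, hWe'])
          (hWf ▸ hf) (Or.inr (hfY.trans hWf.symm)) rfl
        refine ⟨Z', hZ', h1, h2.trans hWf, fun k => ?_⟩
        rcases h3 k with h | h | h
        · exact Or.inl h
        · rw [h]
          exact hWc' k
        · exact Or.inr (Or.inl (Or.inr (Or.inr h)))
    obtain ⟨V, hV, hVt, hVf, hVc⟩ := M.exists_circuit_of_cleanup (t := {e}ᶜ) (f := f)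
      (fun X' hX' Y' hY' _ _ e' => M.elimination_retaining_of_eq_zero hX' hY')
      hZ (fun k hk h => hk (by rw [h]; exact hZe)) hZf
      (fun k s => s = 0 ∨ s = X k ∨ s = Y k) hZc hZ'
      (fun k hk h => hk (by rw [h]; exact hZe')) (hZf' ▸ hf) hZc'
    refine ⟨V, hV, ?_, hVf.trans hZf', fun k => ?_⟩
    · by_contra h
      exact hVt h rfl
    · rcases hVc k with h | h
      · exact Or.inl h
      · exact h

end OrientedMatroid

/-! ### Orthogonality and composition of signed sets -/

namespace SignedSet

variable {E : Type*}

theorem mul_nonneg_of_nonneg : ∀ {s t : SignType}, 0 ≤ s → 0 ≤ t → 0 ≤ s * t := by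
  decide

theorem not_orthogonal_of_nonneg {X Y : SignedSet E} (h : ∀ k, 0 ≤ X k * Y k) {e : E}
    (he : X e * Y e ≠ 0) : ¬ Orthogonal X Y := by
  rintro (h0 | ⟨-, f, hf⟩)
  · exact he (h0 e)
  · exact absurd (h f) (by rw [hf]; decide)

theorem Orthogonal.symm {X Y : SignedSet E} (h : Orthogonal X Y) : Orthogonal Y X := by
  simpa only [Orthogonal, mul_comm] using h

theorem Orthogonal.neg_right {X Y : SignedSet E} (h : Orthogonal X Y) : Orthogonal X (-Y) := by
  rcases h with h | ⟨⟨e, he⟩, f, hf⟩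
  · exact Or.inl fun e => by rw [Pi.neg_apply, mul_neg, h e, SignType.neg_eq_zero_iff]
  · exact Or.inr ⟨⟨f, by rw [Pi.neg_apply, mul_neg, hf]; rfl⟩, e,
      by rw [Pi.neg_apply, mul_neg, he]⟩

theorem reorient_mul_reorient (A : Set E) (X Y : SignedSet E) (e : E) :
    reorient A X e * reorient A Y e = X e * Y e := by
  by_cases h : e ∈ A <;> simp [reorient, h]

theorem orthogonal_reorient_iff (A : Set E) (X Y : SignedSet E) :
    Orthogonal (reorient A X) (reorient A Y) ↔ Orthogonal X Y := by
  simp only [Orthogonal, reorient_mul_reorient]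

@[simp]
theorem reorient_reorient_self (A : Set E) (X : SignedSet E) :
    reorient A (reorient A X) = X := by
  funext e
  by_cases h : e ∈ A <;> simp [reorient, h]

theorem support_neg (X : SignedSet E) : Function.support (-X) = Function.support X := by
  ext e
  simp

/-- The composition `X ∘ Y`: the signs of `X`, completed by those of `Y` where `X` vanishes. -/
noncomputable def comp (X Y : SignedSet E) : SignedSet E :=
  fun e => if X e = 0 then Y e else X e

theorem comp_of_eq_zero {X Y : SignedSet E} {e : E} (h : X e = 0) : comp X Y e = Y e :=
  if_pos h

theorem comp_of_ne_zero {X Y : SignedSet E} {e : E} (h : X e ≠ 0) : comp X Y e = X e :=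
  if_neg h

theorem support_comp (X Y : SignedSet E) :
    Function.support (comp X Y) = Function.support X ∪ Function.support Y := by
  ext e
  by_cases h : X e = 0 <;> simp [comp, h]

theorem reorient_comp (A : Set E) (X Y : SignedSet E) :
    reorient A (comp X Y) = comp (reorient A X) (reorient A Y) := by
  funext e
  by_cases h : e ∈ A <;> by_cases h' : X e = 0 <;> simp [reorient, comp, h, h']

/-- The signed sets orthogonal to all members of `S`. -/
def orth (S : Set (SignedSet E)) : Set (SignedSet E) :=
  {Y | ∀ X ∈ S, Orthogonal X Y}

theorem subset_orth_orth (S : Set (SignedSet E)) : S ⊆ orth (orth S) :=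
  fun _ hX _ hY => (hY _ hX).symm

theorem orth_image_reorient (A : Set E) (S : Set (SignedSet E)) :
    orth (reorient A '' S) = reorient A '' orth S := by
  ext Y
  constructor
  · refine fun h => ⟨reorient A Y, fun X hX => ?_, reorient_reorient_self A Y⟩
    rw [← orthogonal_reorient_iff A, reorient_reorient_self]
    exact h _ ⟨X, hX, rfl⟩
  · rintro ⟨Y, hY, rfl⟩ _ ⟨X, hX, rfl⟩
    exact (orthogonal_reorient_iff A X Y).2 (hY X hX)

/-- A family of signed sets containing the empty one and closed under opposites and
compositions, such as the vectors or the covectors of an oriented matroid. -/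
structure IsCompClosed (V : Set (SignedSet E)) : Prop where
  zero_mem : (0 : SignedSet E) ∈ V
  neg_mem : ∀ X ∈ V, -X ∈ V
  comp_mem : ∀ X ∈ V, ∀ Y ∈ V, comp X Y ∈ V

theorem isCompClosed_orth (S : Set (SignedSet E)) : IsCompClosed (orth S) where
  zero_mem X _ := Or.inl fun e => by simp
  neg_mem Y hY X hX := (hY X hX).neg_right
  comp_mem Y hY Z hZ X hX := by
    have hne : ∀ e, X e * Y e ≠ 0 → X e * comp Y Z e = X e * Y e := fun e h => by
      rw [comp_of_ne_zero (right_ne_zero_of_mul h)]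
    rcases hY X hX with h | ⟨⟨e, he⟩, f, hf⟩
    · have : ∀ e, X e * comp Y Z e = X e * Z e := fun e => by
        rcases mul_eq_zero.1 (h e) with h' | h'
        · rw [h', zero_mul, zero_mul]
        · rw [comp_of_eq_zero h']
      simpa only [Orthogonal, this] using hZ X hX
    · exact Or.inr ⟨⟨e, (hne e (by rw [he]; decide)).trans he⟩,
        f, (hne f (by rw [hf]; decide)).trans hf⟩

end SignedSet

/-! ### Covectors, vectors and the painting lemma -/

namespace OrientedMatroid

open SignedSet

variable {E : Type*} (M : OrientedMatroid E)

/-- The signed sets orthogonal to all circuits. -/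
abbrev covectors : Set (SignedSet E) := orth M.circuits

/-- The signed sets orthogonal to all covectors. That they are unions of circuits is needed for
positive ones only, where it is `exists_circuit_of_mem_vectors`. -/
abbrev vectors : Set (SignedSet E) := orth M.covectors

variable {M}

theorem mem_cocircuits_iff {D : SignedSet E} : D ∈ M.cocircuits ↔
    D ≠ 0 ∧ D ∈ M.covectors ∧ ∀ D' ≠ 0, D' ∈ M.covectors →
      Function.support D' ⊆ Function.support D → Function.support D' = Function.support D :=
  Iff.rfl

variable (M) [Finite E]

/-- An element `e` outside the span of `B` lies in a covector avoiding `B`: if `B` is maximal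
with `e` outside its span, then the complement of `B` is the support of such a covector, whose sign
at `w` is read off from a circuit in `B ∪ {e, w}`. -/
theorem exists_circuit_or_covector (e : E) (B : Set E) (heB : e ∉ B) :
    (∃ C ∈ M.circuits, C e = 1 ∧ ∀ x, x ∉ B → x ≠ e → C x = 0) ∨
      ∃ D ∈ M.covectors, D e = 1 ∧ ∀ b ∈ B, D b = 0 := by
  by_contra! hcon
  obtain ⟨hno, hD⟩ := hcon
  obtain ⟨H, hBH, ⟨heH, hH⟩, hmax⟩ := (Set.toFinite {H : Set E | e ∉ H ∧
    ∀ C ∈ M.circuits, C e = 1 → ∃ x, x ∉ H ∧ x ≠ e ∧ C x ≠ 0}).exists_le_maximal ⟨heB, hno⟩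
  have hfund : ∀ w, w ∉ H → w ≠ e → ∃ C ∈ M.circuits, C e = 1 ∧ C w ≠ 0 ∧
      ∀ x, x ∉ H → x ≠ e → x ≠ w → C x = 0 := by
    intro w hw hwe
    by_contra! hcon
    refine hw (hmax (y := insert w H) ⟨?_, fun C hC hCe => ?_⟩ (Set.subset_insert w H)
      (Set.mem_insert w H))
    · rintro (h | h)
      · exact hwe h.symm
      · exact heH h
    · by_cases hCw : C w = 0
      · obtain ⟨x, hx, hxe, hxC⟩ := hH C hC hCe
        refine ⟨x, ?_, hxe, hxC⟩
        rintro (h | h)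
        · exact hxC (h ▸ hCw)
        · exact hx h
      · obtain ⟨x, hx, hxe, hxw, hxC⟩ := hcon C hC hCe hCw
        refine ⟨x, ?_, hxe, hxC⟩
        rintro (h | h)
        · exact hxw h
        · exact hx h
  choose! C hC hCe hCw hCx using hfund
  classical
  set D : SignedSet E := fun x => if x = e then 1 else if x ∈ H then 0 else -C x x with hDdef
  have hDe : D e = 1 := if_pos rfl
  have hDH : ∀ x ∈ H, D x = 0 := fun x hx => by
    have : x ≠ e := fun h => heH (h ▸ hx)
    simp [hDdef, this, hx]
  have hDw : ∀ w, w ∉ H → w ≠ e → D w = -C w w := fun w hw hwe => by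
    simp [hDdef, hwe, hw]
  -- eliminating an element outside `H ∪ {e}` by means of its circuit keeps the products
  -- nonnegative and nonzero at `e`
  have key : ∀ n, ∀ Z ∈ M.circuits, (∀ x, 0 ≤ Z x * D x) → (∃ x, Z x * D x ≠ 0) →
      {x | x ∉ H ∧ x ≠ e ∧ Z x ≠ 0}.ncard = n → False := by
    intro n
    induction n using Nat.strong_induction_on with
    | _ n ih =>
      rintro Z hZ hpos ⟨x, hx⟩ hn
      have hZe : Z e = 0 ∨ Z e = 1 := by
        have := hpos e
        rwa [hDe, mul_one, SignType.nonneg_iff] at this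
      by_cases hw : ∃ w, w ∉ H ∧ w ≠ e ∧ Z w ≠ 0
      · obtain ⟨w, hwH, hwe, hZw⟩ := hw
        have hZwC : Z w = -C w w := by
          have h1 := hpos w
          rw [hDw w hwH hwe] at h1
          have h2 := hCw w hwH hwe
          revert h1 h2 hZw
          generalize Z w = s
          generalize C w w = t
          revert s t
          decide
        obtain ⟨Z', hZ', hZ'w, hZ'e, hZ'c⟩ := M.strong_elimination (hC w hwH hwe) hZ
          (hCw w hwH hwe) hZwC (f := e) (by rw [hCe w hwH hwe]; decide)
          (by rwa [hCe w hwH hwe])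
        rw [hCe w hwH hwe] at hZ'e
        refine ih _ ?_ Z' hZ' (fun y => ?_) ⟨e, by rw [hZ'e, hDe]; decide⟩ rfl
        · rw [← hn]
          refine Set.ncard_lt_ncard ⟨?_, fun h => (h ⟨hwH, hwe, hZw⟩ : w ∈ _).2.2 hZ'w⟩
          rintro y ⟨h1, h2, h3⟩
          refine ⟨h1, h2, ?_⟩
          rcases hZ'c y with h | h | h
          · exact absurd h h3
          · have hyw : y ≠ w := fun h' => h3 (h' ▸ hZ'w)
            exact absurd (h.trans (hCx w hwH hwe y h1 h2 hyw)) h3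
          · exact h ▸ h3
        · by_cases hyH : y ∈ H
          · rw [hDH y hyH, mul_zero]
          by_cases hye : y = e
          · rw [hye, hZ'e, hDe]
            decide
          by_cases hyw : y = w
          · rw [hyw, hZ'w, zero_mul]
          rcases hZ'c y with h | h | h
          · rw [h, zero_mul]
          · rw [h, hCx w hwH hwe y hyH hye hyw, zero_mul]
          · rw [h]
            exact hpos y
      · push Not at hw
        have hxe : x = e := by
          by_contra hxe
          by_cases hxH : x ∈ H
          · exact hx (by rw [hDH x hxH, mul_zero])
          · exact hx (by rw [hw x hxH hxe, zero_mul])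
        obtain ⟨y, hy, hye, hyZ⟩ := hH Z hZ
          (hZe.resolve_left fun h => hx (by rw [hxe, h, zero_mul]))
        exact hyZ (hw y hy hye)
  obtain ⟨b, hb, hDb⟩ := hD D (fun X hX => by
    by_contra hnot
    rw [Orthogonal, not_or, not_and_or] at hnot
    obtain ⟨h0, h1⟩ := hnot
    push Not at h0 h1
    obtain ⟨x, hx⟩ := h0
    rcases h1 with h1 | h1
    · refine key _ (-X) (M.neg_mem X hX) (fun y => ?_) ⟨x, ?_⟩ rfl
      · have := h1 y
        rw [Pi.neg_apply, neg_mul]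
        revert this
        generalize X y * D y = s
        revert s
        decide
      · rwa [Pi.neg_apply, neg_mul, ne_eq, SignType.neg_eq_zero_iff]
    · exact key _ X hX (fun y => SignType.nonneg_iff_ne_neg_one.2 (h1 y)) ⟨x, hx⟩ rfl) hDe
  exact hDb (hDH b (hBH hb))

/-- The painting lemma, an analogue of Farkas' lemma: for `e`, a set `P` of elements on which
signs are prescribed to be nonnegative and a set `B`, there is either a circuit through `e`
vanishing outside `P ∪ B ∪ {e}` or a covector through `e` vanishing on `B`. -/
theorem painting (e : E) (P B : Set E) (heP : e ∉ P) (heB : e ∉ B) (hPB : Disjoint P B) :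
    (∃ C ∈ M.circuits, C e = 1 ∧ (∀ p ∈ P, 0 ≤ C p) ∧
      ∀ x, x ∉ P → x ∉ B → x ≠ e → C x = 0) ∨
    ∃ D ∈ M.covectors, D e = 1 ∧ (∀ p ∈ P, 0 ≤ D p) ∧ ∀ b ∈ B, D b = 0 := by
  induction P, P.toFinite using Set.Finite.induction_on generalizing B with
  | empty =>
    rcases M.exists_circuit_or_covector e B heB with ⟨C, hC, h1, h2⟩ | ⟨D, hD, h1, h2⟩
    · exact Or.inl ⟨C, hC, h1, by simp, fun x _ => h2 x⟩
    · exact Or.inr ⟨D, hD, h1, by simp, h2⟩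
  | @insert f P hfP _ ih =>
    rw [Set.mem_insert_iff, not_or] at heP
    rw [Set.disjoint_insert_left] at hPB
    -- colour `f` free for circuits, then free for covectors
    rcases ih (insert f B) heP.2 (by simp [heP.1, heB])
      (Set.disjoint_insert_right.2 ⟨hfP, hPB.2⟩) with
      ⟨C, hC, hCe, hCP, hC0⟩ | ⟨D, hD, hDe, hDP, hDB⟩
    swap
    · refine Or.inr ⟨D, hD, hDe, ?_, fun b hb => hDB b (Or.inr hb)⟩
      rintro p (rfl | hp)
      · exact (hDB p (Or.inl rfl)).ge
      · exact hDP p hp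
    rcases ih B heP.2 heB hPB.2 with ⟨C', hC', hC'e, hC'P, hC'0⟩ | ⟨D, hD, hDe, hDP, hDB⟩
    · refine Or.inl ⟨C', hC', hC'e, ?_, fun x hx => hC'0 x fun h => hx (Or.inr h)⟩
      rintro p (rfl | hp)
      · exact (hC'0 p hfP hPB.1 (Ne.symm heP.1)).ge
      · exact hC'P p hp
    by_cases hCf : 0 ≤ C f
    · refine Or.inl ⟨C, hC, hCe, ?_, fun x hx hxB => hC0 x (fun h => hx (Or.inr h)) ?_⟩
      · rintro p (rfl | hp)
        · exact hCf
        · exact hCP p hp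
      · rintro (h | h)
        · exact hx (Or.inl h)
        · exact hxB h
    by_cases hDf : 0 ≤ D f
    · refine Or.inr ⟨D, hD, hDe, ?_, hDB⟩
      rintro p (rfl | hp)
      · exact hDf
      · exact hDP p hp
    -- otherwise the products of `C` and `D` are nonnegative
    refine absurd (hD C hC) (not_orthogonal_of_nonneg (e := e) (fun k => ?_)
      (by rw [hCe, hDe]; decide))
    by_cases hkf : k = f
    · rw [hkf]
      revert hCf hDf
      generalize C f = s
      generalize D f = t
      revert s t
      decide
    by_cases hke : k = e
    · rw [hke, hCe, hDe]
      decide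
    by_cases hkB : k ∈ B
    · rw [hDB k hkB, mul_zero]
    by_cases hkP : k ∈ P
    · exact mul_nonneg_of_nonneg (hCP k hkP) (hDP k hkP)
    · rw [hC0 k hkP (by simp [hkf, hkB]) hke, zero_mul]

/-! ### Decomposition of positive vectors and covectors -/

variable {M}

/-- A positive vector is a union of positive circuits. -/
theorem exists_circuit_of_mem_vectors {v : SignedSet E} (hv : v ∈ M.vectors) (hpos : v.Positive)
    {e : E} (he : v e ≠ 0) :
    ∃ C ∈ M.circuits, C.Positive ∧ C e ≠ 0 ∧ Function.support C ⊆ Function.support v := by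
  rcases M.painting e (Function.support v \ {e}) ∅ (by simp) (by simp) (by simp) with
    ⟨C, hC, hCe, hCP, hC0⟩ | ⟨D, hD, hDe, hDP, -⟩
  · have hsupp : ∀ x, v x = 0 → C x = 0 := fun x hx =>
      hC0 x (fun h => h.1 hx) (by simp) (fun h => he (h ▸ hx))
    refine ⟨C, hC, fun x => ?_, by rw [hCe]; decide, fun x hx hvx => hx (hsupp x hvx)⟩
    by_cases hx : v x = 0
    · exact (hsupp x hx).ge
    · by_cases hxe : x = e
      · rw [hxe, hCe]
        decide
      · exact hCP x ⟨hx, hxe⟩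
  · refine absurd (hv D hD) (not_orthogonal_of_nonneg (e := e) (fun k => ?_)
      (by rwa [hDe, one_mul]))
    by_cases hk : v k = 0
    · rw [hk, mul_zero]
    · by_cases hke : k = e
      · rw [hke, hDe, one_mul]
        exact hpos e
      · exact mul_nonneg_of_nonneg (hDP k ⟨hk, hke⟩) (hpos k)

/-- Elimination of `f` between a positive covector `X` and a covector `Y` of smaller support,
retaining `e`. -/
theorem covector_elimination {X Y : SignedSet E} (hX : X ∈ M.covectors) (hY : Y ∈ M.covectors)
    (hpos : X.Positive) (hYX : Function.support Y ⊆ Function.support X) {e f : E}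
    (hXe : X e ≠ 0) (hYe : 0 ≤ Y e) (hf : Y f = -1) :
    ∃ Z ∈ M.covectors, Z e = 1 ∧ Z f = 0 ∧ Function.support Z ⊆ Function.support X ∧
      ∀ k, Z k = -1 → Y k = -1 := by
  have hY0 : ∀ k, X k = 0 → Y k = 0 := fun k hk => by
    by_contra h
    exact hYX h hk
  have hef : e ≠ f := fun h => absurd hYe (by rw [h, hf]; decide)
  have hdisj : Disjoint ({k | X k ≠ 0 ∧ 0 ≤ Y k} \ {e}) (insert f {k | X k = 0}) := by
    rw [Set.disjoint_left]
    rintro k ⟨⟨h1, h2⟩, -⟩ (h | h)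
    · rw [h, hf] at h2
      exact absurd h2 (by decide)
    · exact h1 h
  rcases M.painting e ({k | X k ≠ 0 ∧ 0 ≤ Y k} \ {e}) (insert f {k | X k = 0}) (by simp)
    (by simp [hef, hXe]) hdisj with ⟨C, hC, hCe, hCP, hC0⟩ | ⟨D, hD, hDe, hDP, hDB⟩
  · -- the sign of `C` at `f` contradicts the orthogonality to `X` or to `Y`
    exfalso
    have hC' : ∀ k, X k ≠ 0 → k ≠ f → 0 ≤ C k ∧ (Y k = -1 → C k = 0) := fun k hk hkf => by
      by_cases hke : k = e
      · rw [hke, hCe]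
        exact ⟨by decide, fun h => absurd hYe (by rw [h]; decide)⟩
      by_cases hYk : 0 ≤ Y k
      · exact ⟨hCP k ⟨⟨hk, hYk⟩, hke⟩, fun h => absurd hYk (by rw [h]; decide)⟩
      · have := hC0 k (fun h => hYk h.1.2) (by simp [hkf, hk]) hke
        exact ⟨this.ge, fun _ => this⟩
    have hXf : X f = 1 := by
      have h1 : X f ≠ 0 := fun h => by
        have := hY0 f h
        rw [hf] at this
        exact absurd this (by decide)
      exact (SignType.nonneg_iff.1 (hpos f)).resolve_left h1
    by_cases hCf : 0 ≤ C f
    · refine not_orthogonal_of_nonneg (e := e) (fun k => ?_) (by rwa [hCe, one_mul]) (hX C hC)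
      by_cases hkf : k = f
      · rw [hkf, hXf, mul_one]
        exact hCf
      by_cases hk : X k = 0
      · rw [hk, mul_zero]
      · exact mul_nonneg_of_nonneg (hC' k hk hkf).1 (hpos k)
    · have hCf' : C f * Y f = 1 := by
        rw [hf]
        revert hCf
        generalize C f = s
        revert s
        decide
      refine not_orthogonal_of_nonneg (e := f) (fun k => ?_) (by rw [hCf']; decide) (hY C hC)
      by_cases hkf : k = f
      · rw [hkf, hCf']
        decide
      by_cases hk : X k = 0
      · rw [hY0 k hk, mul_zero]
      · by_cases hYk : Y k = -1
        · rw [(hC' k hk hkf).2 hYk, zero_mul]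
        · exact mul_nonneg_of_nonneg (hC' k hk hkf).1 (SignType.nonneg_iff_ne_neg_one.2 hYk)
  · refine ⟨D, hD, hDe, hDB f (Or.inl rfl), fun k hk hXk => hk (hDB k (Or.inr hXk)),
      fun k hk => ?_⟩
    by_contra hYk
    have hXk : X k ≠ 0 := fun h => by
      rw [hDB k (Or.inr h)] at hk
      exact absurd hk (by decide)
    have hke : k ≠ e := fun h => by
      rw [h, hDe] at hk
      exact absurd hk (by decide)
    exact SignType.nonneg_iff_ne_neg_one.1
      (hDP k ⟨⟨hXk, SignType.nonneg_iff_ne_neg_one.2 hYk⟩, hke⟩) hk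

/-- If the support of a positive covector through `e` is not minimal, repeated elimination yields
a smaller positive covector through `e`. -/
theorem exists_positive_covector_of_ssubset {D D' : SignedSet E} (hD : D ∈ M.covectors)
    (hpos : D.Positive) {e : E} (he : D e ≠ 0) (hD' : D' ∈ M.covectors) (hD'0 : D' ≠ 0)
    (hsub : Function.support D' ⊂ Function.support D) :
    ∃ Y ∈ M.covectors, Y.Positive ∧ Y e ≠ 0 ∧ Function.support Y ⊂ Function.support D := by
  have hDf : ∀ Y : SignedSet E, Function.support Y ⊆ Function.support D → ∀ f, Y f = -1 →
      f ∈ Function.support D := fun Y hY f hf => hY (by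
    rw [Function.mem_support, hf]
    decide)
  have hstart : ∃ Y ∈ M.covectors, Y e = 1 ∧ Function.support Y ⊂ Function.support D := by
    have hneg := (isCompClosed_orth M.circuits).neg_mem D' hD'
    rcases SignType.trichotomy (D' e) with h | h | h
    · exact ⟨-D', hneg, by rw [Pi.neg_apply, h]; rfl, (support_neg D').symm ▸ hsub⟩
    · obtain ⟨Y, hY, hYe, hYs, f, hf⟩ : ∃ Y ∈ M.covectors, Y e = 0 ∧
          Function.support Y ⊆ Function.support D ∧ ∃ f, Y f = -1 := by
        obtain ⟨f, hf⟩ := Function.ne_iff.1 hD'0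
        rcases SignType.trichotomy (D' f) with h' | h' | h'
        · exact ⟨D', hD', h, hsub.1, f, h'⟩
        · exact absurd h' hf
        · exact ⟨-D', hneg, by rw [Pi.neg_apply, h]; rfl, (support_neg D').symm ▸ hsub.1, f,
            by rw [Pi.neg_apply, h']⟩
      obtain ⟨Z, hZ, hZe, hZf, hZs, -⟩ := covector_elimination hD hY hpos hYs he hYe.ge hf
      exact ⟨Z, hZ, hZe, hZs, fun h => h (hDf Y hYs f hf) hZf⟩
    · exact ⟨D', hD', h, hsub⟩
  obtain ⟨Y, ⟨hY, hYe, hYs⟩, hmin⟩ := Set.exists_min_image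
    {Y | Y ∈ M.covectors ∧ Y e = 1 ∧ Function.support Y ⊂ Function.support D}
    (fun Y => {k | Y k = -1}.ncard) (Set.toFinite _) hstart
  refine ⟨Y, hY, fun f => ?_, by rw [hYe]; decide, hYs⟩
  rw [SignType.nonneg_iff_ne_neg_one]
  intro hf
  obtain ⟨Z, hZ, hZe, hZf, hZs, hZn⟩ := covector_elimination hD hY hpos hYs.1 he
    (by rw [hYe]; decide) hf
  refine absurd (hmin Z ⟨hZ, hZe, hZs, fun h => h (hDf Y hYs.1 f hf) hZf⟩) (not_le.2 ?_)
  refine Set.ncard_lt_ncard ⟨hZn, fun h => ?_⟩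
  have : Z f = -1 := h hf
  rw [hZf] at this
  exact absurd this (by decide)

/-- A positive covector is a union of positive cocircuits. -/
theorem exists_cocircuit_of_mem_covectors {v : SignedSet E} (hv : v ∈ M.covectors)
    (hpos : v.Positive) {e : E} (he : v e ≠ 0) :
    ∃ D ∈ M.cocircuits, D.Positive ∧ D e ≠ 0 ∧ Function.support D ⊆ Function.support v := by
  obtain ⟨D, ⟨hD, hDpos, hDe, hDv⟩, hmin⟩ := Set.exists_min_image
    {D | D ∈ M.covectors ∧ D.Positive ∧ D e ≠ 0 ∧ Function.support D ⊆ Function.support v}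
    (fun D => (Function.support D).ncard) (Set.toFinite _) ⟨v, hv, hpos, he, subset_rfl⟩
  refine ⟨D, mem_cocircuits_iff.2 ⟨fun h => hDe (by rw [h]; rfl), hD,
    fun D' hD'0 hD' hsub => ?_⟩, hDpos, hDe, hDv⟩
  by_contra hne
  obtain ⟨Y, hY, hYpos, hYe, hYs⟩ :=
    exists_positive_covector_of_ssubset hD hDpos hDe hD' hD'0 (hsub.ssubset_of_ne hne)
  exact absurd (hmin Y ⟨hY, hYpos, hYe, hYs.1.trans hDv⟩) (not_le.2 (Set.ncard_lt_ncard hYs))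

end OrientedMatroid

/-! ### Unions of positive members of a family -/

namespace SignedSet

variable {E : Type*}

/-- The union of the positive members of `V` supported in `s`. -/
def positiveUnion (V : Set (SignedSet E)) (s : Set E) : Set E :=
  {x | ∃ v ∈ V, v.Positive ∧ Function.support v ⊆ s ∧ v x ≠ 0}

variable {V W : Set (SignedSet E)} {s t : Set E}

theorem positiveUnion_mono (h : s ⊆ t) : positiveUnion V s ⊆ positiveUnion V t :=
  fun _ ⟨v, hv, hpos, hs, hx⟩ => ⟨v, hv, hpos, hs.trans h, hx⟩

theorem positiveUnion_subset : positiveUnion V s ⊆ s := fun _ ⟨_, _, _, hs, hx⟩ => hs hx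

theorem Positive.comp {X Y : SignedSet E} (hX : X.Positive)
    (hY : ∀ e, X e = 0 → 0 ≤ Y e) : (comp X Y).Positive := fun e => by
  by_cases h : X e = 0
  · rw [comp_of_eq_zero h]
    exact hY e h
  · rw [comp_of_ne_zero h]
    exact hX e

/-- As `V` is closed under compositions, the union of its positive members supported in `s` is
the support of one of them. -/
theorem IsCompClosed.exists_support_eq [Finite E] (hV : IsCompClosed V) (s : Set E) :
    ∃ v ∈ V, v.Positive ∧ Function.support v = positiveUnion V s := by
  obtain ⟨v, ⟨hv, hpos, hs⟩, hmax⟩ := Set.exists_max_image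
    {v | v ∈ V ∧ v.Positive ∧ Function.support v ⊆ s} (fun v => (Function.support v).ncard)
    (Set.toFinite _) ⟨0, hV.zero_mem, fun _ => le_rfl, by simp⟩
  refine ⟨v, hv, hpos, Set.Subset.antisymm (fun x hx => ⟨v, hv, hpos, hs, hx⟩) ?_⟩
  rintro x ⟨u, hu, hupos, hus, hux⟩
  have := hmax (SignedSet.comp v u) ⟨hV.comp_mem v hv u hu, hpos.comp fun e _ => hupos e,
    by rw [support_comp]; exact Set.union_subset hs hus⟩
  rw [support_comp] at this
  rw [Set.eq_of_subset_of_ncard_le Set.subset_union_left this]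
  exact Or.inr hux

theorem positiveUnion_disjoint (h : ∀ v ∈ V, ∀ w ∈ W, Orthogonal v w) (s t : Set E) :
    Disjoint (positiveUnion V s) (positiveUnion W t) := by
  rw [Set.disjoint_left]
  rintro x ⟨v, hv, hvpos, -, hvx⟩ ⟨w, hw, hwpos, -, hwx⟩
  exact not_orthogonal_of_nonneg (fun k => mul_nonneg_of_nonneg (hvpos k) (hwpos k))
    (mul_ne_zero hvx hwx) (h v hv w hw)

/-- A set containing or avoiding `B` is reoriented on `B` by a global sign. -/
theorem IsCompClosed.exists_nonneg_on {A B : Set E} (hV : IsCompClosed V)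
    (hAB : B ⊆ A ∨ Disjoint B A) {u : SignedSet E} (hu : u ∈ reorient A '' V)
    (hpos : u.Positive) :
    ∃ c ∈ V, Function.support c = Function.support u ∧ ∀ x ∈ B, 0 ≤ c x := by
  obtain ⟨c, hc, rfl⟩ := hu
  rcases hAB with h | h
  · refine ⟨-c, hV.neg_mem c hc, by rw [support_neg, support_reorient], fun x hx => ?_⟩
    simpa [reorient, h hx] using hpos x
  · refine ⟨c, hc, by rw [support_reorient], fun x hx => ?_⟩
    simpa [reorient, Set.disjoint_left.1 h hx] using hpos x

/-! ### Active elements and parts of a family of signed sets -/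

section Order

variable [LinearOrder E]

/-- The smallest elements of the positive members of `V`. -/
def activeSet (V : Set (SignedSet E)) : Set E := {a | a ∈ positiveUnion V (Set.Ici a)}

/-- The part of the active partition belonging to the active element `a`: the elements in a
positive member of `V` with smallest element at least `a`, but in none whose smallest element is
larger. -/
def activePart (V : Set (SignedSet E)) (a : E) : Set E :=
  positiveUnion V (Set.Ici a) \ positiveUnion V (Set.Ioi a)

theorem isLeast_activePart {a : E} (ha : a ∈ activeSet V) : IsLeast (activePart V a) a :=
  ⟨⟨ha, fun h => lt_irrefl a (positiveUnion_subset h)⟩, fun _ hx => positiveUnion_subset hx.1⟩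

theorem disjoint_activePart {a b : E} (hab : a ≠ b) :
    Disjoint (activePart V a) (activePart V b) := by
  rw [Set.disjoint_left]
  rintro x ⟨hxa, hxa'⟩ ⟨hxb, hxb'⟩
  rcases hab.lt_or_gt with h | h
  · exact hxa' (positiveUnion_mono (Set.Ici_subset_Ioi.2 h) hxb)
  · exact hxb' (positiveUnion_mono (Set.Ici_subset_Ioi.2 h) hxa)

theorem activePart_subset_positiveUnion_univ (V : Set (SignedSet E)) (a : E) :
    activePart V a ⊆ positiveUnion V Set.univ :=
  fun _ hx => positiveUnion_mono (Set.subset_univ _) hx.1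

variable [Finite E]

theorem exists_active_of_mem {v : SignedSet E} (hv : v ∈ V) (hpos : v.Positive) {x : E}
    (hx : v x ≠ 0) : ∃ a ∈ activeSet V, v a ≠ 0 ∧ Function.support v ⊆ Set.Ici a := by
  obtain ⟨a, ha, hmin⟩ := Set.exists_min_image (Function.support v) id (Set.toFinite _) ⟨x, hx⟩
  exact ⟨a, ⟨v, hv, hpos, hmin, ha⟩, ha, hmin⟩

theorem exists_mem_activePart {x : E} (hx : x ∈ positiveUnion V s) :
    ∃ a ∈ activeSet V, x ∈ activePart V a := by
  obtain ⟨v, hv, hpos, -, hvx⟩ := hx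
  obtain ⟨b, hb, -, hbv⟩ := exists_active_of_mem hv hpos hvx
  obtain ⟨a, ⟨ha, hxa⟩, hmax⟩ := Set.exists_max_image
    {a | a ∈ activeSet V ∧ x ∈ positiveUnion V (Set.Ici a)} id (Set.toFinite _)
    ⟨b, hb, v, hv, hpos, hbv, hvx⟩
  refine ⟨a, ha, hxa, ?_⟩
  rintro ⟨u, hu, hupos, hus, hux⟩
  obtain ⟨c, hc, huc, hcu⟩ := exists_active_of_mem hu hupos hux
  exact absurd (hmax c ⟨hc, u, hu, hupos, hcu, hux⟩) (not_le.2 (hus huc))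

/-! ### Reorientation on a union of parts -/

/-- If each part is contained in `A` or disjoint from it, composing positive members of `V`,
each taken with the sign wanted on the part which it adds, shows that nothing is lost by
reorientation. -/
theorem IsCompClosed.positiveUnion_subset_reorient {A : Set E} (hV : IsCompClosed V)
    (hA : ∀ a ∈ activeSet V, activePart V a ⊆ A ∨ Disjoint (activePart V a) A)
    (hs : IsUpperSet s) : positiveUnion V s ⊆ positiveUnion (reorient A '' V) s := by
  suffices h : ∃ w ∈ V, Function.support w = positiveUnion V s ∧ (reorient A w).Positive by
    obtain ⟨w, hw, hws, hwpos⟩ := h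
    intro x hx
    refine ⟨_, ⟨w, hw, rfl⟩, hwpos, ?_, ?_⟩
    · rw [support_reorient, hws]
      exact positiveUnion_subset
    · rw [← hws] at hx
      exact fun h => hx ((reorient_eq_zero A w x).1 h)
  induction hn : s.ncard using Nat.strong_induction_on generalizing s with
  | _ n ih =>
    rcases s.eq_empty_or_nonempty with rfl | hne
    · refine ⟨0, hV.zero_mem, ?_, fun e => ((reorient_eq_zero A 0 e).2 rfl).ge⟩
      rw [Set.eq_empty_of_subset_empty (positiveUnion_subset (V := V) (s := ∅))]
      simp
    obtain ⟨a, ha, hmin⟩ := Set.exists_min_image s id (Set.toFinite _) hne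
    obtain rfl : s = Set.Ici a := Set.Subset.antisymm hmin fun x hx => hs hx ha
    obtain ⟨w, hw, hws, hwpos⟩ := ih _ (hn ▸ Set.ncard_lt_ncard
      ⟨Set.Ioi_subset_Ici_self, fun h => lt_irrefl a (h (Set.self_mem_Ici : a ∈ _))⟩)
      (isUpperSet_Ioi a) rfl
    by_cases hact : a ∈ activeSet V
    · obtain ⟨v, hv, hvpos, hvs⟩ := hV.exists_support_eq (Set.Ici a)
      have hsupp : ∀ v', Function.support v' = Function.support v →
          Function.support (SignedSet.comp w v') = positiveUnion V (Set.Ici a) := fun v' h => by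
        rw [support_comp, hws, h, hvs]
        exact Set.union_eq_right.2 (positiveUnion_mono Set.Ioi_subset_Ici_self)
      have hpart : ∀ e, reorient A w e = 0 → v e = 0 ∨ e ∈ activePart V a := fun e he => by
        by_cases hve : v e = 0
        · exact Or.inl hve
        · have h1 : e ∈ positiveUnion V (Set.Ici a) := hvs ▸ hve
          exact Or.inr ⟨h1, fun h => (hws ▸ h : e ∈ Function.support w)
            ((reorient_eq_zero A w e).1 he)⟩
      rcases hA a hact with h | h
      · refine ⟨SignedSet.comp w (-v), hV.comp_mem w hw _ (hV.neg_mem v hv),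
          hsupp _ (support_neg v), ?_⟩
        rw [reorient_comp]
        refine hwpos.comp fun e he => ?_
        rcases hpart e he with h' | h'
        · exact ((reorient_eq_zero A _ e).2 (by rw [Pi.neg_apply, h']; rfl)).ge
        · simpa [reorient, h h'] using hvpos e
      · refine ⟨SignedSet.comp w v, hV.comp_mem w hw v hv, hsupp _ rfl, ?_⟩
        rw [reorient_comp]
        refine hwpos.comp fun e he => ?_
        rcases hpart e he with h' | h'
        · exact ((reorient_eq_zero A _ e).2 h').ge
        · simpa [reorient, Set.disjoint_left.1 h h'] using hvpos e
    · refine ⟨w, hw, hws.trans (Set.Subset.antisymm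
        (positiveUnion_mono Set.Ioi_subset_Ici_self) ?_), hwpos⟩
      rintro x ⟨v, hv, hvpos, hvs, hx⟩
      refine ⟨v, hv, hvpos, fun y hy => lt_of_le_of_ne (hvs hy) ?_, hx⟩
      rintro rfl
      exact hact ⟨v, hv, hvpos, hvs, hy⟩

/-- Nothing is gained by reorientation either, provided that the reoriented positive members
stay inside the active parts and a further part `B` contained in `A` or disjoint from it: on the
first part which it meets, such a member has constant sign, so that composing it with a positive
member gives a positive member of `V` not allowed by the definition of the parts. -/
theorem IsCompClosed.positiveUnion_reorient_subset {A B : Set E} (hV : IsCompClosed V)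
    (hA : ∀ a ∈ activeSet V, activePart V a ⊆ A ∨ Disjoint (activePart V a) A)
    (hB : B ⊆ A ∨ Disjoint B A)
    (hAB : positiveUnion (reorient A '' V) Set.univ ⊆ positiveUnion V Set.univ ∪ B)
    (hs : IsUpperSet s) : positiveUnion (reorient A '' V) s ⊆ positiveUnion V s := by
  rintro x ⟨u, hu, hupos, hus, hux⟩
  -- `u` avoids `B`
  have huV : Function.support u ⊆ positiveUnion V Set.univ := by
    intro y hy
    by_contra hyV
    obtain ⟨c, hc, hcs, hcB⟩ := hV.exists_nonneg_on hB hu hupos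
    obtain ⟨v, hv, hvpos, hvs⟩ := hV.exists_support_eq Set.univ
    refine hyV ⟨SignedSet.comp v c, hV.comp_mem v hv c hc, hvpos.comp fun e he => ?_,
      Set.subset_univ _, ?_⟩
    · by_cases hce : c e = 0
      · exact hce.ge
      · have hue : e ∈ Function.support u := hcs ▸ hce
        refine hcB e ((hAB ⟨u, hu, hupos, Set.subset_univ _, hue⟩).resolve_left fun h => ?_)
        rw [← hvs] at h
        exact h he
    · have : y ∈ Function.support (SignedSet.comp v c) := by
        rw [support_comp, hcs]
        exact Or.inr hy
      exact this
  obtain ⟨b, hb, hxb⟩ := exists_mem_activePart (huV hux)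
  obtain ⟨a, ⟨ha, y, hya, huy⟩, hmin⟩ := Set.exists_min_image
    {a | a ∈ activeSet V ∧ ∃ y ∈ activePart V a, u y ≠ 0} id (Set.toFinite _)
    ⟨b, hb, x, hxb, hux⟩
  have hua : Function.support u ⊆ positiveUnion V (Set.Ici a) := fun z hz => by
    obtain ⟨c, hc, hzc⟩ := exists_mem_activePart (huV hz)
    exact positiveUnion_mono (Set.Ici_subset_Ici.2 (hmin c ⟨hc, z, hzc, hz⟩)) hzc.1
  by_cases has : a ∈ s
  · exact positiveUnion_mono (fun z hz => hs hz has) (hua hux)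
  exfalso
  have hsa : s ⊆ Set.Ioi a := fun z hz => not_le.1 fun h => has (hs h hz)
  obtain ⟨c, hc, hcs, hca⟩ := hV.exists_nonneg_on (hA a ha) hu hupos
  obtain ⟨v, hv, hvpos, hvs⟩ := hV.exists_support_eq (Set.Ioi a)
  refine hya.2 ⟨SignedSet.comp v c, hV.comp_mem v hv c hc, hvpos.comp fun e he => ?_, ?_, ?_⟩
  · by_cases hce : c e = 0
    · exact hce.ge
    · have hue : e ∈ Function.support u := hcs ▸ hce
      refine hca e ⟨hua hue, fun h => ?_⟩
      rw [← hvs] at h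
      exact h he
  · rw [support_comp, hvs, hcs]
    exact Set.union_subset positiveUnion_subset (hus.trans hsa)
  · have : y ∈ Function.support (SignedSet.comp v c) := by
      rw [support_comp, hcs]
      exact Or.inr huy
    exact this

/-- Reorientation on a union of parts changes neither the unions of positive members of `V` nor
those of an orthogonal family `W`. The part outside all positive members is the hybrid part. -/
theorem IsCompClosed.positiveUnion_reorient_eq {A : Set E} (hV : IsCompClosed V)
    (hW : IsCompClosed W) (hVW : ∀ v ∈ V, ∀ w ∈ W, Orthogonal v w)
    (hAV : ∀ a ∈ activeSet V, activePart V a ⊆ A ∨ Disjoint (activePart V a) A)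
    (hAW : ∀ a ∈ activeSet W, activePart W a ⊆ A ∨ Disjoint (activePart W a) A)
    (hA : (positiveUnion V Set.univ ∪ positiveUnion W Set.univ)ᶜ ⊆ A ∨
      Disjoint (positiveUnion V Set.univ ∪ positiveUnion W Set.univ)ᶜ A)
    (hs : IsUpperSet s) : positiveUnion (reorient A '' V) s = positiveUnion V s := by
  refine Set.Subset.antisymm (hV.positiveUnion_reorient_subset hAV hA (fun x hx => ?_) hs)
    (hV.positiveUnion_subset_reorient hAV hs)
  have hdis : Disjoint (positiveUnion (reorient A '' V) Set.univ)
      (positiveUnion (reorient A '' W) Set.univ) := by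
    refine positiveUnion_disjoint ?_ _ _
    rintro _ ⟨v, hv, rfl⟩ _ ⟨w, hw, rfl⟩
    exact (orthogonal_reorient_iff A v w).2 (hVW v hv w hw)
  by_cases h : x ∈ positiveUnion V Set.univ
  · exact Or.inl h
  · refine Or.inr fun h' => h'.elim h fun hxW => ?_
    exact Set.disjoint_left.1 hdis hx (hW.positiveUnion_subset_reorient hAW isUpperSet_univ hxW)

end Order

end SignedSet

namespace SignedSet

theorem reorient_reorient {E : Type*} (A B : Set E) (X : SignedSet E) :
    reorient B (reorient A X) = reorient (A ∆ B) X := by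
  funext e
  by_cases hA : e ∈ A <;> by_cases hB : e ∈ B <;> simp [reorient, Set.mem_symmDiff, hA, hB]

end SignedSet

/-! ### Unions of disjoint sets -/

section PairwiseDisjoint

variable {α : Type*} {P T T' : Set (Set α)}

theorem mem_sUnion_iff_of_pairwiseDisjoint (hP : P.PairwiseDisjoint id) (hT : T ⊆ P) {B : Set α}
    (hB : B ∈ P) {x : α} (hx : x ∈ B) : x ∈ ⋃₀ T ↔ B ∈ T := by
  refine ⟨fun ⟨B', hB', hx'⟩ => ?_, fun h => ⟨B, h, hx⟩⟩
  rwa [hP.elim_set hB (hT hB') x hx hx']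

theorem subset_or_disjoint_sUnion (hP : P.PairwiseDisjoint id) (hT : T ⊆ P) {B : Set α}
    (hB : B ∈ P) : B ⊆ ⋃₀ T ∨ Disjoint B (⋃₀ T) := by
  by_cases h : B ∈ T
  · exact Or.inl (Set.subset_sUnion_of_mem h)
  · exact Or.inr (Set.disjoint_left.2 fun x hx hxT =>
      h ((mem_sUnion_iff_of_pairwiseDisjoint hP hT hB hx).1 hxT))

theorem sUnion_symmDiff (hP : P.PairwiseDisjoint id) (hT : T ⊆ P) (hT' : T' ⊆ P) :
    ⋃₀ (T ∆ T') = (⋃₀ T) ∆ (⋃₀ T') := by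
  have hsub : T ∆ T' ⊆ P := fun B hB => hB.elim (fun h => hT h.1) fun h => hT' h.1
  ext x
  by_cases hx : ∃ B ∈ P, x ∈ B
  · obtain ⟨B, hB, hxB⟩ := hx
    simp only [Set.mem_symmDiff, mem_sUnion_iff_of_pairwiseDisjoint hP hsub hB hxB,
      mem_sUnion_iff_of_pairwiseDisjoint hP hT hB hxB,
      mem_sUnion_iff_of_pairwiseDisjoint hP hT' hB hxB]
  · have h : ∀ S ⊆ P, x ∉ ⋃₀ S := fun S hS ⟨B, hB, hxB⟩ => hx ⟨B, hS hB, hxB⟩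
    simp only [Set.mem_symmDiff, h _ hsub, h _ hT, h _ hT', false_and, or_self]

end PairwiseDisjoint

namespace OrientedMatroid

open SignedSet

/-! ### Perspectives and reorientation -/

section Perspective

variable {E : Type*} {M N : OrientedMatroid E}

/-- In a perspective `M → N` the covectors of `N` are covectors of `M`: a conformal union of
circuits is orthogonal to a signed set orthogonal to each of them. -/
theorem IsPerspective.covectors_subset (h : M.IsPerspective N) : N.covectors ⊆ M.covectors := by
  intro D hD C hC
  obtain ⟨S, hS, -, hU⟩ := h C hC
  have hagree : ∀ X ∈ S, ∀ e, X e ≠ 0 → C e = X e := fun X hX e he => by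
    rcases SignType.trichotomy (X e) with h | h | h
    · rw [h, (hU e).2.2 ⟨X, hX, h⟩]
    · exact absurd h he
    · rw [h, (hU e).1.2 ⟨X, hX, h⟩]
  by_cases hall : ∀ X ∈ S, ∀ e, X e * D e = 0
  · refine Or.inl fun e => ?_
    rcases SignType.trichotomy (C e) with h | h | h
    · obtain ⟨X, hX, hXe⟩ := (hU e).2.1 h
      rw [h, ← hXe, hall X hX e]
    · rw [h, zero_mul]
    · obtain ⟨X, hX, hXe⟩ := (hU e).1.1 h
      rw [h, ← hXe, hall X hX e]
  · push Not at hall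
    obtain ⟨X, hX, e, he⟩ := hall
    obtain ⟨⟨f, hf⟩, g, hg⟩ := (hD X (hS hX)).resolve_left fun h => he (h e)
    refine Or.inr ⟨⟨f, ?_⟩, g, ?_⟩
    · rw [hagree X hX f (left_ne_zero_of_mul (b := D f) (by rw [hf]; decide)), hf]
    · rw [hagree X hX g (left_ne_zero_of_mul (b := D g) (by rw [hg]; decide)), hg]

theorem IsPerspective.orthogonal (h : M.IsPerspective N) :
    ∀ v ∈ M.vectors, ∀ w ∈ N.covectors, Orthogonal v w :=
  fun _ hv w hw => (hv w (h.covectors_subset hw)).symm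

theorem IsPerspective.reorient (h : M.IsPerspective N) (A : Set E) :
    (M.reorient A).IsPerspective (N.reorient A) := by
  rintro _ ⟨C, hC, rfl⟩
  obtain ⟨S, hS, hconf, hU⟩ := h C hC
  refine ⟨SignedSet.reorient A '' S, Set.image_mono hS, ?_, fun e => ?_⟩
  · rintro _ ⟨X, hX, rfl⟩ _ ⟨Y, hY, rfl⟩ hne e hXe hYe
    have := hconf hX hY (fun h => hne (by rw [h])) e
      (fun h => hXe ((reorient_eq_zero A X e).2 h)) (fun h => hYe ((reorient_eq_zero A Y e).2 h))
    simp only [SignedSet.reorient, this]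
  · simp only [Set.exists_mem_image]
    by_cases he : e ∈ A
    · simpa only [SignedSet.reorient, he, if_true, neg_eq_one, neg_eq_neg_one] using
        ⟨(hU e).2, (hU e).1⟩
    · simpa only [SignedSet.reorient, he, if_false] using hU e

theorem covectors_reorient (M : OrientedMatroid E) (A : Set E) :
    (M.reorient A).covectors = SignedSet.reorient A '' M.covectors :=
  orth_image_reorient A M.circuits

theorem vectors_reorient (M : OrientedMatroid E) (A : Set E) :
    (M.reorient A).vectors = SignedSet.reorient A '' M.vectors := by
  rw [vectors, covectors_reorient, orth_image_reorient]

theorem reorient_reorient (M : OrientedMatroid E) (A B : Set E) :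
    (M.reorient A).reorient B = M.reorient (A ∆ B) := by
  ext1
  exact (Set.image_image _ _ _).trans
    (Set.image_congr fun X _ => SignedSet.reorient_reorient A B X)

end Perspective

variable {E : Type*} [LinearOrder E] [Finite E]

/-! ### The active filtration -/

section Filtration

theorem enum_mem (S : Set E) (i : Fin S.ncard) : enum S i ∈ S :=
  S.toFinite.mem_toFinset.1 (Finset.orderEmbOfFin_mem _ _ i)

theorem exists_enum_eq {S : Set E} {a : E} (ha : a ∈ S) : ∃ i, enum S i = a := by
  have h := Finset.range_orderEmbOfFin S.toFinite.toFinset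
    (Set.ncard_eq_toFinset_card S).symm
  have : a ∈ Set.range (enum S) := by
    rw [enum, h]
    simpa using ha
  exact this

/-- The active filtration attached to a family of signed sets. As for `filtrationG`, the index
starts at `0` and the set is empty from the number of active elements on; `filtrationH` is the
complement for the family of covectors. -/
def activeFiltration (V : Set (SignedSet E)) (k : ℕ) : Set E :=
  {x | ∃ hk : k < (activeSet V).ncard, x ∈ positiveUnion V (Set.Ici (enum (activeSet V) ⟨k, hk⟩))}

variable {V : Set (SignedSet E)}

theorem activeFiltration_of_lt {k : ℕ} (hk : k < (activeSet V).ncard) :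
    activeFiltration V k = positiveUnion V (Set.Ici (enum (activeSet V) ⟨k, hk⟩)) := by
  ext x
  exact ⟨fun ⟨_, h⟩ => h, fun h => ⟨hk, h⟩⟩

theorem activeFiltration_succ {k : ℕ} (hk : k < (activeSet V).ncard) :
    activeFiltration V (k + 1) = positiveUnion V (Set.Ioi (enum (activeSet V) ⟨k, hk⟩)) := by
  ext x
  constructor
  · rintro ⟨hk', hx⟩
    refine positiveUnion_mono (Set.Ici_subset_Ioi.2 ?_) hx
    exact (enum (activeSet V)).strictMono (Nat.lt_succ_self k)
  · rintro ⟨v, hv, hpos, hs, hx⟩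
    obtain ⟨a, ha, hva, hav⟩ := exists_active_of_mem hv hpos hx
    obtain ⟨i, rfl⟩ := exists_enum_eq ha
    have hki : k + 1 ≤ i := (enum (activeSet V)).lt_iff_lt.1 (hs hva)
    refine ⟨hki.trans_lt i.2, v, hv, hpos, hav.trans (Set.Ici_subset_Ici.2 ?_), hx⟩
    exact (enum (activeSet V)).monotone hki

theorem activeFiltration_zero : activeFiltration V 0 = positiveUnion V Set.univ := by
  refine Set.Subset.antisymm (fun x ⟨_, h⟩ => positiveUnion_mono (Set.subset_univ _) h) ?_
  rintro x ⟨v, hv, hpos, -, hx⟩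
  obtain ⟨a, ha, hva, hav⟩ := exists_active_of_mem hv hpos hx
  obtain ⟨i, rfl⟩ := exists_enum_eq ha
  refine ⟨i.pos, v, hv, hpos, hav.trans (Set.Ici_subset_Ici.2 ?_), hx⟩
  exact (enum (activeSet V)).monotone (Nat.zero_le i)

theorem setOf_activeFiltration_sdiff :
    {B | ∃ k < (activeSet V).ncard, B = activeFiltration V k \ activeFiltration V (k + 1)} =
      activePart V '' activeSet V := by
  ext B
  constructor
  · rintro ⟨k, hk, rfl⟩
    refine ⟨_, enum_mem _ ⟨k, hk⟩, ?_⟩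
    rw [activeFiltration_of_lt hk, activeFiltration_succ hk, activePart]
  · rintro ⟨a, ha, rfl⟩
    obtain ⟨⟨k, hk⟩, rfl⟩ := exists_enum_eq ha
    refine ⟨k, hk, ?_⟩
    rw [activeFiltration_of_lt hk, activeFiltration_succ hk, activePart]

end Filtration

/-! ### The active partition -/

section ActivePartition

variable (M N : OrientedMatroid E)

theorem active_eq : M.active = activeSet M.vectors := by
  ext a
  constructor
  · rintro ⟨C, hC, hpos, ha, hmin⟩
    exact ⟨C, subset_orth_orth _ hC, hpos, hmin, ha⟩
  · rintro ⟨v, hv, hpos, hs, ha⟩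
    obtain ⟨C, hC, hCpos, hCa, hCv⟩ := exists_circuit_of_mem_vectors hv hpos ha
    exact ⟨C, hC, hCpos, hCa, hCv.trans hs⟩

theorem dualActive_eq : N.dualActive = activeSet N.covectors := by
  ext a
  constructor
  · rintro ⟨D, hD, hpos, ha, hmin⟩
    exact ⟨D, hD.2.1, hpos, hmin, ha⟩
  · rintro ⟨v, hv, hpos, hs, ha⟩
    obtain ⟨D, hD, hDpos, hDa, hDv⟩ := exists_cocircuit_of_mem_covectors hv hpos ha
    exact ⟨D, hD, hDpos, hDa, hDv.trans hs⟩

theorem filtrationG_eq (k : ℕ) : M.filtrationG k = activeFiltration M.vectors k := by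
  unfold filtrationG activeFiltration
  rw [← active_eq]
  ext x
  refine exists_congr fun hk => ?_
  constructor
  · rintro ⟨C, hC, hpos, hs, hx⟩
    exact ⟨C, subset_orth_orth _ hC, hpos, hs, hx⟩
  · rintro ⟨v, hv, hpos, hs, hx⟩
    obtain ⟨C, hC, hCpos, hCx, hCv⟩ := exists_circuit_of_mem_vectors hv hpos hx
    exact ⟨C, hC, hCpos, hCv.trans hs, hCx⟩

theorem filtrationH_eq (k : ℕ) : N.filtrationH k = (activeFiltration N.covectors k)ᶜ := by
  unfold filtrationH activeFiltration
  rw [← dualActive_eq, compl_inj_iff]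
  ext x
  refine exists_congr fun hk => ?_
  constructor
  · rintro ⟨D, hD, hpos, hs, hx⟩
    exact ⟨D, hD.2.1, hpos, hs, hx⟩
  · rintro ⟨v, hv, hpos, hs, hx⟩
    obtain ⟨D, hD, hDpos, hDx, hDv⟩ := exists_cocircuit_of_mem_covectors hv hpos hx
    exact ⟨D, hD, hDpos, hDv.trans hs, hDx⟩

/-- The active partition in terms of vectors and covectors: its parts are indexed by the active
elements. -/
theorem activePartition_eq : M.activePartition N =
    { cyclicParts := activePart M.vectors '' activeSet M.vectors
      acyclicParts := activePart N.covectors '' activeSet N.covectors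
      hybridPart :=
        (positiveUnion M.vectors Set.univ ∪ positiveUnion N.covectors Set.univ)ᶜ } := by
  ext1
  · simp only [activePartition, filtrationG_eq, active_eq]
    exact setOf_activeFiltration_sdiff
  · simp only [activePartition, filtrationH_eq, dualActive_eq, compl_sdiff_compl]
    exact setOf_activeFiltration_sdiff
  · simp only [activePartition, filtrationG_eq, filtrationH_eq, activeFiltration_zero]
    rw [Set.compl_union, Set.sdiff_eq, Set.inter_comm]

variable {M N}

theorem pairwiseDisjoint_parts (h : M.IsPerspective N) :
    (M.activePartition N).parts.PairwiseDisjoint id := by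
  have hVW := positiveUnion_disjoint h.orthogonal Set.univ Set.univ
  rw [activePartition_eq]
  rintro B hB B' hB' hne
  have hself : ∀ {V : Set (SignedSet E)} {a b : E}, activePart V a ≠ activePart V b →
      Disjoint (activePart V a) (activePart V b) :=
    fun h => disjoint_activePart fun h' => h (by rw [h'])
  have hcross : ∀ a b, Disjoint (activePart M.vectors a) (activePart N.covectors b) :=
    fun a b => hVW.mono (activePart_subset_positiveUnion_univ _ a)
      (activePart_subset_positiveUnion_univ _ b)
  have hV : ∀ a, Disjoint (activePart M.vectors a)
      (positiveUnion M.vectors Set.univ ∪ positiveUnion N.covectors Set.univ)ᶜ := fun a =>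
    disjoint_compl_right.mono_left
      ((activePart_subset_positiveUnion_univ _ a).trans Set.subset_union_left)
  have hW : ∀ a, Disjoint (activePart N.covectors a)
      (positiveUnion M.vectors Set.univ ∪ positiveUnion N.covectors Set.univ)ᶜ := fun a =>
    disjoint_compl_right.mono_left
      ((activePart_subset_positiveUnion_univ _ a).trans Set.subset_union_right)
  rcases hB with (⟨a, -, rfl⟩ | ⟨a, -, rfl⟩) | rfl <;>
    rcases hB' with (⟨b, -, rfl⟩ | ⟨b, -, rfl⟩) | rfl
  · exact hself hne
  · exact hcross a b
  · exact hV a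
  · exact (hcross b a).symm
  · exact hself hne
  · exact hW a
  · exact (hV b).symm
  · exact (hW b).symm
  · exact absurd rfl hne

/-- Reorienting a union of parts preserves the active partition. -/
theorem activePartition_reorient_sUnion (h : M.IsPerspective N) {T : Set (Set E)}
    (hT : T ⊆ (M.activePartition N).parts) :
    (M.reorient (⋃₀ T)).activePartition (N.reorient (⋃₀ T)) = M.activePartition N := by
  have hsat : ∀ B ∈ (M.activePartition N).parts, B ⊆ ⋃₀ T ∨ Disjoint B (⋃₀ T) :=
    fun B hB => subset_or_disjoint_sUnion (pairwiseDisjoint_parts h) hT hB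
  generalize ⋃₀ T = A at hsat ⊢
  rw [activePartition_eq] at hsat ⊢
  rw [activePartition_eq, vectors_reorient, covectors_reorient]
  have hMc := isCompClosed_orth M.covectors
  have hNc := isCompClosed_orth N.circuits
  have hM : ∀ a ∈ activeSet M.vectors,
      activePart M.vectors a ⊆ A ∨ Disjoint (activePart M.vectors a) A :=
    fun a ha => hsat _ (Or.inl (Or.inl ⟨a, ha, rfl⟩))
  have hN : ∀ a ∈ activeSet N.covectors,
      activePart N.covectors a ⊆ A ∨ Disjoint (activePart N.covectors a) A :=
    fun a ha => hsat _ (Or.inl (Or.inr ⟨a, ha, rfl⟩))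
  have hH := hsat _ (Or.inr rfl)
  have hV : ∀ s : Set E, IsUpperSet s →
      positiveUnion (SignedSet.reorient A '' M.vectors) s = positiveUnion M.vectors s :=
    fun s hs => hMc.positiveUnion_reorient_eq hNc h.orthogonal hM hN hH hs
  have hW : ∀ s : Set E, IsUpperSet s →
      positiveUnion (SignedSet.reorient A '' N.covectors) s = positiveUnion N.covectors s :=
    fun s hs => hNc.positiveUnion_reorient_eq hMc
      (fun v hv w hw => (h.orthogonal w hw v hv).symm) hN hM (by rwa [Set.union_comm]) hs
  have hact : ∀ {V V' : Set (SignedSet E)},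
      (∀ s : Set E, IsUpperSet s → positiveUnion V' s = positiveUnion V s) →
      activePart V' = activePart V ∧ activeSet V' = activeSet V := fun h => by
    constructor
    · funext a
      rw [activePart, activePart, h _ (isUpperSet_Ici a), h _ (isUpperSet_Ioi a)]
    · ext a
      rw [activeSet, activeSet, Set.mem_ofPred_eq, Set.mem_ofPred_eq, h _ (isUpperSet_Ici a)]
  rw [(hact hV).1, (hact hV).2, (hact hW).1, (hact hW).2, hV _ isUpperSet_univ,
    hW _ isUpperSet_univ]

end ActivePartition

/-! ### Activity classes -/

section ActivityClass

variable {M N : OrientedMatroid E}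

theorem pairwiseDisjoint_activeParts (h : M.IsPerspective N) (A : Set E) :
    (M.activeParts N A).PairwiseDisjoint id :=
  (pairwiseDisjoint_parts (h.reorient A)).subset Set.subset_union_left

theorem activeParts_symmDiff_sUnion (h : M.IsPerspective N) {A : Set E} {T : Set (Set E)}
    (hT : T ⊆ M.activeParts N A) :
    M.activeParts N (A ∆ ⋃₀ T) = M.activeParts N A := by
  unfold activeParts at hT ⊢
  rw [← reorient_reorient, ← reorient_reorient,
    activePartition_reorient_sUnion (h.reorient A) (hT.trans Set.subset_union_left)]

theorem mem_activityClass_self (M N : OrientedMatroid E) (A : Set E) :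
    A ∈ M.activityClass N A :=
  ⟨∅, Set.empty_subset _, by rw [Set.sUnion_empty]; exact (symmDiff_bot A).symm⟩

theorem activityClass_subset (h : M.IsPerspective N) {A A' : Set E}
    (hA' : A' ∈ M.activityClass N A) : M.activityClass N A' ⊆ M.activityClass N A := by
  obtain ⟨T, hT, rfl⟩ := hA'
  rintro _ ⟨T', hT', rfl⟩
  rw [activeParts_symmDiff_sUnion h hT] at hT'
  refine ⟨T ∆ T', fun B hB => hB.elim (fun h => hT h.1) fun h => hT' h.1, ?_⟩
  rw [sUnion_symmDiff (pairwiseDisjoint_activeParts h A) hT hT', symmDiff_assoc]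

theorem activityClass_eq (h : M.IsPerspective N) {A A' : Set E}
    (hA' : A' ∈ M.activityClass N A) : M.activityClass N A' = M.activityClass N A := by
  refine Set.Subset.antisymm (activityClass_subset h hA') (activityClass_subset h ?_)
  obtain ⟨T, hT, rfl⟩ := hA'
  refine ⟨T, ?_, by rw [symmDiff_symmDiff_cancel_right]⟩
  rwa [activeParts_symmDiff_sUnion h hT]

theorem isPartition_range_activityClass (h : M.IsPerspective N) :
    Setoid.IsPartition (Set.range (M.activityClass N)) := by
  refine ⟨?_, fun A => ⟨M.activityClass N A, ⟨⟨A, rfl⟩, mem_activityClass_self M N A⟩, ?_⟩⟩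
  · rintro ⟨A, hA⟩
    exact (hA ▸ mem_activityClass_self M N A : A ∈ (∅ : Set (Set E)))
  · rintro _ ⟨⟨B, rfl⟩, hAB⟩
    exact (activityClass_eq h hAB).symm

theorem symmDiff_mem_activityClass_iff {A X : Set E} :
    A ∆ X ∈ M.activityClass N A ↔ ∃ T ⊆ M.activeParts N A, X = ⋃₀ T := by
  simp only [activityClass, Set.mem_ofPred_eq, symmDiff_right_inj]

/-- The smallest elements of the cyclic and acyclic parts are the active and dual active
elements. -/
theorem exists_isLeast_iff (A : Set E) (a : E) :
    (∃ B ∈ M.activeParts N A, IsLeast B a) ↔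
      a ∈ (M.reorient A).active ∪ (N.reorient A).dualActive := by
  rw [activeParts, activePartition_eq, active_eq, dualActive_eq]
  constructor
  · rintro ⟨_, ⟨b, hb, rfl⟩ | ⟨b, hb, rfl⟩, ha⟩
    · rw [ha.unique (isLeast_activePart hb)]
      exact Or.inl hb
    · rw [ha.unique (isLeast_activePart hb)]
      exact Or.inr hb
  · rintro (ha | ha)
    · exact ⟨_, Or.inl ⟨a, ha, rfl⟩, isLeast_activePart ha⟩
    · exact ⟨_, Or.inr ⟨a, ha, rfl⟩, isLeast_activePart ha⟩

theorem exists_isLeast_of_mem_activeParts {A B : Set E} (hB : B ∈ M.activeParts N A) :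
    ∃ a, IsLeast B a := by
  rw [activeParts, activePartition_eq] at hB
  rcases hB with ⟨b, hb, rfl⟩ | ⟨b, hb, rfl⟩ <;> exact ⟨b, isLeast_activePart hb⟩

theorem exists_orderIso_activityClass (h : M.IsPerspective N) (A : Set E) :
    ∃ φ : Set ↥((M.reorient A).active ∪ (N.reorient A).dualActive) ≃o
        {X : Set E // A ∆ X ∈ M.activityClass N A},
      ∀ S, (φ S : Set E) = ⋃₀ {B ∈ M.activeParts N A | ∃ a ∈ S, IsLeast B (a : E)} := by
  have hdis := pairwiseDisjoint_activeParts h A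
  let f : Set ↥((M.reorient A).active ∪ (N.reorient A).dualActive) →
      {X : Set E // A ∆ X ∈ M.activityClass N A} := fun S =>
    ⟨⋃₀ {B ∈ M.activeParts N A | ∃ a ∈ S, IsLeast B (a : E)},
      symmDiff_mem_activityClass_iff.2 ⟨_, Set.sep_subset _ _, rfl⟩⟩
  have hf : ∀ S S', f S ≤ f S' ↔ S ≤ S' := fun S S' => by
    constructor
    · intro hle a ha
      obtain ⟨B, hB, hBa⟩ := (exists_isLeast_iff A (a : E)).2 a.2
      obtain ⟨-, a', ha', hBa'⟩ :=
        (mem_sUnion_iff_of_pairwiseDisjoint hdis (Set.sep_subset _ _) hB hBa.1).1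
          (hle ⟨B, ⟨hB, a, ha, hBa⟩, hBa.1⟩)
      rwa [Subtype.ext (hBa.unique hBa')]
    · exact fun hle => Set.sUnion_subset_sUnion
        fun B ⟨hB, a, ha, hBa⟩ => ⟨hB, a, hle ha, hBa⟩
  have hsurj : Function.Surjective f := by
    rintro ⟨X, hX⟩
    obtain ⟨T, hT, rfl⟩ := symmDiff_mem_activityClass_iff.1 hX
    refine ⟨{a | ∃ B ∈ T, IsLeast B (a : E)},
      Subtype.ext (congrArg Set.sUnion (Set.ext fun B => ?_))⟩
    constructor
    · rintro ⟨hB, a, ⟨B', hB', hBa'⟩, hBa⟩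
      rwa [hdis.elim_set hB (hT hB') (a : E) hBa.1 hBa'.1]
    · intro hB
      obtain ⟨a, ha⟩ := exists_isLeast_of_mem_activeParts (hT hB)
      exact ⟨hT hB, ⟨a, (exists_isLeast_iff A a).1 ⟨B, hT hB, ha⟩⟩, ⟨B, hB, ha⟩, ha⟩
  exact ⟨RelIso.ofSurjective (OrderEmbedding.ofMapLEIff f hf) hsurj, fun S => rfl⟩

end ActivityClass

end OrientedMatroid

theorem mainTheorem2 {E : Type*} [LinearOrder E] [Finite E] (M N : OrientedMatroid E)
    (hMN : M.IsPerspective N) :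
    (∀ T ⊆ (M.activePartition N).parts,
      (M.reorient (⋃₀ T)).IsPerspective (N.reorient (⋃₀ T)) ∧
      (M.reorient (⋃₀ T)).activePartition (N.reorient (⋃₀ T)) = M.activePartition N) ∧
    Setoid.IsPartition (Set.range (M.activityClass N)) ∧
    ∀ A : Set E,
      ∃ φ : Set ↥((M.reorient A).active ∪ (N.reorient A).dualActive) ≃o
          {X : Set E // A ∆ X ∈ M.activityClass N A},
        ∀ S, (φ S : Set E) = ⋃₀ {B ∈ M.activeParts N A | ∃ a ∈ S, IsLeast B (a : E)} :=
  ⟨fun _ hT => ⟨hMN.reorient _, OrientedMatroid.activePartition_reorient_sUnion hMN hT⟩,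
    OrientedMatroid.isPartition_range_activityClass hMN,
    OrientedMatroid.exists_orderIso_activityClass hMN⟩
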